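/- Let $Q$ be a smooth 4-dimensional manifold with a smooth metric $g$ of signature $(1,3)$, let $A$ be a smooth 1-form on $Q$, $F=\mathrm dA$, $U\in C^\infty(Q)$, and let $m>0$, $c>0$, $e\in\mathbb R$. On $TQ$, with projection $\tau_Q$, let $J$ be the vertical endomorphism, $\Delta$ the Liouville vector field, $\xi^\vee$ the vertical lift of a vector field $\xi:TQ\to TQ$ along $\tau_Q$, and $T$ the identity of $TQ$ seen as a vector field along $\tau_Q$, so that $(i_TF)(u)=F(u,\cdot)$ and $(i_T\mathrm dU)(u)=\mathrm dU(u)$. Put $\theta_g(w)=g(u,T\tau_Q w)$ for $w\in T_u(TQ)$, $\omega_g=-\mathrm d\theta_g$, $E_g(u)=\tfrac12 g(u,u)$, $v=\sqrt{2E_g}$. The form $\omega_g$ is nondegenerate; let $S_g$ be the geodesic vector field, that is, the unique one with $i_{S_g}\omega_g=\mathrm dE_g$. For a lagrangian $L$ put $\theta_L={}^tJ\circ \mathrm dL$, $\omega_L=-\mathrm d\theta_L$, $\widehat\omega_L(w)=i_w\omega_L$, $E_L=\Delta\cdot L-L$. Let $\phi(u)=g(u,u)-c^2$ and $M=\{\phi=0\}\subset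 TQ$. Along $M$ one has ${}^tJ\circ\mathrm d\phi\neq0$, and $M\to Q$ is surjective; so $M$ is a hypersurface and $M\to Q$ is a surjective submersion. The constrained system of $L$ is the pair $(A_L,f_L)$, where $$A_L:TM\to T^*(TQ)|_M/G',\qquad G'={}^tJ\big((TM)^{\perp}\big),$$ is induced by $\widehat\omega_L$ ($(TM)^\perp$ is the annihilator of $TM$ in $T^*(TQ)|_M$) and $f_L$ is the section of $T^*(TQ)|_M/G'$ induced by $\mathrm dE_L$. A solution is a smooth vector field $X$ on $M$ (tangent to $M$) with $A_L\circ X=f_L$. The system is regular if $A_L$ is an isomorphism, and consistent if it has a solution. A vector field $X$ on $M$ is second-order if $J\circ X=\Delta$ on $M$. Consider $$L_1(u)=-mc\,g(u,u)^{1/2}-\tfrac ec\langle A,u\rangle-U\quad(\text{on } g(u,u)>0),\qquad L_2(u)=-\tfrac12 m\,g(u,u)-\tfrac ec\langle A,u\rangle-U ,$$ and, on $M$, $$X=S_g+\tfrac1m(\operatorname{grad}U)^\vee-\tfrac e{mc}\big((i_TF)^\sharp\big)^\vee-\tfrac1{mc^2}(i_T\mathrm dU)\,\Delta .$$ Then: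 1. $L_2$ is regular ($\omega_{L_2}$ is nondegenerate on $TQ$), its constrained system is regular, and $X$ is its unique solution. 2. $L_1$ is singular ($\omega_{L_1}$ is degenerate at every $u$ with $g(u,u)>0$). Its constrained system is consistent, but $A_{L_1}$ is not bijective at any point of $M$. Its solutions are exactly the fields $Y+\mu\Sigma$ on $M$, with $\mu$ an arbitrary smooth function on $M$, where $Y=\frac1m(\operatorname{grad}U)^\vee-\frac1{mc^2}(i_T\mathrm dU)\Delta$ and $\Sigma=S_g-\frac{ev}{mc^2}((i_TF)^\sharp)^\vee$. 3. $X$ is second-order, and it is the unique second-order solution of both constrained systems, that of $L_1$ and that of $L_2$. -/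

import Mathlib

open scoped Manifold ContDiff

noncomputable section

/-! ## Differential forms on a manifold (without boundary) -/

section Forms

/-- The differential `df` of a real function, as a 1-form. -/
def differential {E : Type*} [NormedAddCommGroup E] [NormedSpace ℝ E] {H : Type*}
    [TopologicalSpace H] (I : ModelWithCorners ℝ E H) {N : Type*} [TopologicalSpace N]
    [ChartedSpace H N] (f : N → ℝ) (x : N) : TangentSpace I x →L[ℝ] ℝ :=
  mfderiv I 𝓘(ℝ, ℝ) f x

/-- The local expression of the 1-form `θ` in the chart `extChartAt I x₀`, that is, its pullback
by the inverse of the chart. -/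
def oneFormInChart {E : Type*} [NormedAddCommGroup E] [NormedSpace ℝ E] {H : Type*}
    [TopologicalSpace H] (I : ModelWithCorners ℝ E H) {N : Type*} [TopologicalSpace N]
    [ChartedSpace H N] (θ : ∀ x : N, TangentSpace I x →L[ℝ] ℝ) (x₀ : N) (y : E) : E →L[ℝ] ℝ :=
  (θ ((extChartAt I x₀).symm y)).comp (mfderiv 𝓘(ℝ, E) I (extChartAt I x₀).symm y)

/-- The exterior derivative `dθ` of a 1-form on a manifold without boundary, computed at `x` in
the chart at `x`: if `a = ∑ aᵢ dyⁱ` is the local expression of `θ`, then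
`dθ(w, w') = (D_w a)(w') - (D_w' a)(w)`. -/
def extDerivOneForm {E : Type*} [NormedAddCommGroup E] [NormedSpace ℝ E] {H : Type*}
    [TopologicalSpace H] (I : ModelWithCorners ℝ E H) {N : Type*} [TopologicalSpace N]
    [ChartedSpace H N] (θ : ∀ x : N, TangentSpace I x →L[ℝ] ℝ) (x : N) :
    TangentSpace I x →L[ℝ] TangentSpace I x →L[ℝ] ℝ :=
  let D : E →L[ℝ] E →L[ℝ] ℝ := fderiv ℝ (oneFormInChart I θ x) (extChartAt I x x)
  let dy : E →L[ℝ] E := mfderiv I 𝓘(ℝ, E) (extChartAt I x) x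
  let dθ : E →L[ℝ] E →L[ℝ] ℝ := (D - D.flip).bilinearComp dy dy
  dθ

end Forms

/-! ## The tangent bundle of a smooth manifold modelled on a normed space `E` -/

/-- The tangent bundle `TQ`, a smooth manifold modelled on `E × E`. -/
abbrev TB (E : Type*) [NormedAddCommGroup E] [NormedSpace ℝ E]
    (Q : Type*) [TopologicalSpace Q] [ChartedSpace E Q] [IsManifold 𝓘(ℝ, E) ∞ Q] : Type _ :=
  TangentBundle 𝓘(ℝ, E) Q

/-- The tangent space `T_qQ`. -/
abbrev TSp (E : Type*) [NormedAddCommGroup E] [NormedSpace ℝ E]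
    {Q : Type*} [TopologicalSpace Q] [ChartedSpace E Q] (q : Q) : Type _ :=
  TangentSpace 𝓘(ℝ, E) q

/-- The tangent space `T_u(TQ)`. -/
abbrev TTSp {E : Type*} [NormedAddCommGroup E] [NormedSpace ℝ E]
    {Q : Type*} [TopologicalSpace Q] [ChartedSpace E Q] [IsManifold 𝓘(ℝ, E) ∞ Q]
    (u : TB E Q) : Type _ :=
  TangentSpace (𝓘(ℝ, E)).tangent u

/-- The vertical lift `T_qN → T_u(TN)` at `u ∈ T_qN`: the derivative at `u` of the inclusion of
the fibre `T_qN` in `TN`. -/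
def verticalLift {E : Type*} [NormedAddCommGroup E] [NormedSpace ℝ E] {H : Type*}
    [TopologicalSpace H] (I : ModelWithCorners ℝ E H) {N : Type*} [TopologicalSpace N]
    [ChartedSpace H N] [IsManifold I 1 N] (u : TangentBundle I N) :
    TangentSpace I u.proj →L[ℝ] TangentSpace I.tangent u :=
  mfderiv 𝓘(ℝ, E) I.tangent
    (fun ξ : E => Bundle.TotalSpace.mk' E (E := (TangentSpace I : N → Type _)) u.proj ξ) u.snd

section TangentBundleGeometry

variable {E : Type*} [NormedAddCommGroup E] [NormedSpace ℝ E]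
  {Q : Type*} [TopologicalSpace Q] [ChartedSpace E Q] [IsManifold 𝓘(ℝ, E) ∞ Q]

/-- The tangent map at `u` of the projection `τ_Q : TQ → Q`. -/
def dproj (u : TB E Q) : TTSp u →L[ℝ] TSp E u.proj :=
  mfderiv (𝓘(ℝ, E)).tangent 𝓘(ℝ, E) (Bundle.TotalSpace.proj : TB E Q → Q) u

/-- The vertical lift `T_qQ → T_u(TQ)` at `u ∈ T_qQ`. -/
def vertLift (u : TB E Q) : TSp E u.proj →L[ℝ] TTSp u :=
  verticalLift 𝓘(ℝ, E) u

/-- The vertical endomorphism `J` of `T(TQ)`. -/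
def vertEndo (u : TB E Q) : TTSp u →L[ℝ] TTSp u :=
  (vertLift u).comp (dproj u)

/-- The Liouville vector field `Δ` of `TQ`. -/
def liouville (u : TB E Q) : TTSp u :=
  vertLift u u.snd

/-- The second-order condition `J ∘ X = Δ` on the points of the subset `M` of `TQ`. -/
def IsSecondOrderOn (M : Set (TB E Q)) (X : ∀ u : TB E Q, TTSp u) : Prop :=
  ∀ u ∈ M, vertEndo u (X u) = liouville u

/-- The vector field `X` is smooth on `M ⊆ TQ`. -/
def IsSmoothFieldOn (M : Set (TB E Q)) (X : ∀ u : TB E Q, TTSp u) : Prop :=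
  ContMDiffOn (𝓘(ℝ, E)).tangent (𝓘(ℝ, E)).tangent.tangent ∞
    (fun u : TB E Q => (⟨u, X u⟩ : TangentBundle (𝓘(ℝ, E)).tangent (TB E Q))) M

/-! ## Lagrangian mechanics -/

/-- Lagrange's 1-form `θ_L = ᵗJ ∘ dL`. -/
def lagrangeOneForm (L : TB E Q → ℝ) (u : TB E Q) : TTSp u →L[ℝ] ℝ :=
  (differential (𝓘(ℝ, E)).tangent L u).comp (vertEndo u)

/-- Lagrange's 2-form `ω_L = - dθ_L`; as a map `w ↦ i_w ω_L` it is `ω̂_L`. -/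
def lagrangeTwoForm (L : TB E Q → ℝ) (u : TB E Q) : TTSp u →L[ℝ] TTSp u →L[ℝ] ℝ :=
  -extDerivOneForm (𝓘(ℝ, E)).tangent (lagrangeOneForm L) u

/-- The lagrangian energy `E_L = Δ · L - L`. -/
def lagrangeEnergy (L : TB E Q → ℝ) (u : TB E Q) : ℝ :=
  differential (𝓘(ℝ, E)).tangent L u (liouville u) - L u

/-! ## Lagrangian mechanics with one nonholonomic constraint `φ = 0`

The constraint submanifold is `M = {φ = 0}`, where `dφ ≠ 0` at the points of `M`. The
constrained system is the linearly singular system `(A : TM → F, f)` with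
`F = T*(TQ)|_M / G'`, `G' = ᵗJ((TM)^⊢)`, and `A`, `f` induced by `ω̂_L` and `dE_L`. -/

/-- The constraint subset `M ⊆ TQ`. -/
def constraintSet (φ : TB E Q → ℝ) : Set (TB E Q) := {u | φ u = 0}

/-- The tangent space `T_uM = Ker d_uφ`. -/
def constraintTangent (φ : TB E Q → ℝ) (u : TB E Q) : Submodule ℝ (TTSp u) :=
  LinearMap.ker (differential (𝓘(ℝ, E)).tangent φ u).toLinearMap

/-- The annihilator `(T_uM)^⊢ ⊆ T*_u(TQ)`. -/
def constraintAnnihilator (φ : TB E Q → ℝ) (u : TB E Q) : Submodule ℝ (TTSp u →L[ℝ] ℝ) where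
  carrier := {α | ∀ w ∈ constraintTangent φ u, α w = 0}
  zero_mem' := by intro w _; rfl
  add_mem' := by
    intro a b ha hb w hw
    simp [ha w hw, hb w hw]
  smul_mem' := by
    intro t a ha w hw
    simp [ha w hw]

/-- The fibre at `u` of the bundle of constraint forces, `G' = ᵗJ((TM)^⊢)`. -/
def constraintForces (φ : TB E Q → ℝ) (u : TB E Q) : Submodule ℝ (TTSp u →L[ℝ] ℝ) where
  carrier := {β | ∃ α ∈ constraintAnnihilator φ u, α.comp (vertEndo u) = β}
  zero_mem' := ⟨0, Submodule.zero_mem _, by ext; simp⟩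
  add_mem' := by
    rintro _ _ ⟨a, ha, rfl⟩ ⟨b, hb, rfl⟩
    exact ⟨a + b, Submodule.add_mem _ ha hb, by ext; simp⟩
  smul_mem' := by
    rintro t _ ⟨a, ha, rfl⟩
    exact ⟨t • a, Submodule.smul_mem _ t ha, by ext; simp⟩

/-- The fibre at `u` of the vector bundle `F = T*(TQ)|_M / G'`. -/
abbrev constrainedFibre (φ : TB E Q → ℝ) (u : TB E Q) : Type _ :=
  (TTSp u →L[ℝ] ℝ) ⧸ constraintForces φ u

/-- The linear map `A_u : T_uM → F_u` of the constrained system. -/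
def constrainedMap (L φ : TB E Q → ℝ) (u : TB E Q) :
    constraintTangent φ u →ₗ[ℝ] constrainedFibre φ u :=
  (constraintForces φ u).mkQ ∘ₗ (lagrangeTwoForm L u).toLinearMap ∘ₗ
    (constraintTangent φ u).subtype

/-- The section `f` of the constrained system. -/
def constrainedSection (L φ : TB E Q → ℝ) (u : TB E Q) : constrainedFibre φ u :=
  (constraintForces φ u).mkQ (differential (𝓘(ℝ, E)).tangent (lagrangeEnergy L) u)

/-- The constrained system is regular: `A : TM → F` is an isomorphism. -/
def IsRegularConstrained (L φ : TB E Q → ℝ) : Prop :=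
  ∀ u ∈ constraintSet φ, Function.Bijective (constrainedMap L φ u)

/-- `X` is a (smooth) vector field on `M`, tangent to `M`, with `A ∘ X = f` on `M`. The values of
`X` outside `M` are irrelevant. -/
def IsConstrainedSolution (L φ : TB E Q → ℝ) (X : ∀ u : TB E Q, TTSp u) : Prop :=
  IsSmoothFieldOn (constraintSet φ) X ∧
    ∀ u ∈ constraintSet φ, ∃ h : X u ∈ constraintTangent φ u,
      constrainedMap L φ u ⟨X u, h⟩ = constrainedSection L φ u

/-- The constrained system is everywhere consistent: `A ∘ X = f` has a solution on all of `M`. -/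
def IsConsistentConstrained (L φ : TB E Q → ℝ) : Prop :=
  ∃ X : ∀ u : TB E Q, TTSp u, IsConstrainedSolution L φ X

end TangentBundleGeometry

/-! ## Spacetime -/

/-- A smooth metric tensor of signature `(1,3)` on a 4-dimensional manifold `Q`
(modelled on the normed space `E`). -/
structure LorentzMetric (E : Type*) [NormedAddCommGroup E] [NormedSpace ℝ E]
    (Q : Type*) [TopologicalSpace Q] [ChartedSpace E Q]
    [IsManifold 𝓘(ℝ, E) ∞ Q] where
  /-- The scalar product `g_q` on `T_qQ`. -/
  val : ∀ q : Q, TSp E q →L[ℝ] TSp E q →L[ℝ] ℝ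
  symm : ∀ (q : Q) (v w : TSp E q), val q v w = val q w v
  signature : ∀ q : Q, ∃ b : Module.Basis (Fin 4) ℝ (TSp E q), ∀ i j : Fin 4,
    val q (b i) (b j) = if i = j then (if i = 0 then 1 else -1) else 0
  smooth : ContMDiff 𝓘(ℝ, E) (𝓘(ℝ, E).prod 𝓘(ℝ, E →L[ℝ] E →L[ℝ] ℝ)) ∞
    (fun q => Bundle.TotalSpace.mk' (E →L[ℝ] E →L[ℝ] ℝ)
      (E := fun q : Q => TSp E q →L[ℝ] TSp E q →L[ℝ] ℝ) q (val q))

/-- A smooth 1-form on a manifold. -/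
structure SmoothOneForm (E : Type*) [NormedAddCommGroup E] [NormedSpace ℝ E]
    (Q : Type*) [TopologicalSpace Q] [ChartedSpace E Q]
    [IsManifold 𝓘(ℝ, E) ∞ Q] where
  /-- The covector at `q`. -/
  val : ∀ q : Q, TSp E q →L[ℝ] ℝ
  smooth : ContMDiff 𝓘(ℝ, E) (𝓘(ℝ, E).prod 𝓘(ℝ, E →L[ℝ] ℝ)) ∞
    (fun q => Bundle.TotalSpace.mk' (E →L[ℝ] ℝ) (E := fun q : Q => TSp E q →L[ℝ] ℝ) q (val q))

namespace LorentzMetric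

variable {E : Type*} [NormedAddCommGroup E] [NormedSpace ℝ E]
  {Q : Type*} [TopologicalSpace Q] [ChartedSpace E Q] [IsManifold 𝓘(ℝ, E) ∞ Q]

/-- The musical isomorphism `♯ : T*_qQ → T_qQ`, inverse of `ĝ_q` (see `flat_sharp`). -/
def sharp (g : LorentzMetric E Q) (q : Q) : (TSp E q →L[ℝ] ℝ) →L[ℝ] TSp E q :=
  (g.val q).inverse

/-- The function `g(u, u)` on `TQ`. -/
def normSq (g : LorentzMetric E Q) (u : TB E Q) : ℝ := g.val u.proj u.snd u.snd

/-- The energy `E_g(u) = g(u, u) / 2`. -/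
def energy (g : LorentzMetric E Q) (u : TB E Q) : ℝ := 1 / 2 * g.normSq u

/-- The function `v = √(2 E_g)`, meaningful on time-like vectors. -/
def speed (g : LorentzMetric E Q) (u : TB E Q) : ℝ := Real.sqrt (2 * g.energy u)

/-- The 1-form `θ_g = ĝ^*(θ_Q)` on `TQ`: `θ_g(w) = g(u, Tτ_Q w)` for `w ∈ T_u(TQ)`. -/
def oneForm (g : LorentzMetric E Q) (u : TB E Q) : TTSp u →L[ℝ] ℝ :=
  (g.val u.proj u.snd).comp (dproj u)

/-- The 2-form `ω_g = - dθ_g` on `TQ`. -/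
def twoForm (g : LorentzMetric E Q) (u : TB E Q) : TTSp u →L[ℝ] TTSp u →L[ℝ] ℝ :=
  -extDerivOneForm (𝓘(ℝ, E)).tangent g.oneForm u

/-- The geodesic vector field `S_g`, defined by `i_{S_g} ω_g = dE_g` (`ω_g` is symplectic). -/
def geodesicField (g : LorentzMetric E Q) (u : TB E Q) : TTSp u :=
  (g.twoForm u).inverse (differential (𝓘(ℝ, E)).tangent g.energy u)

/-- The vertical lift `(grad U)^∨`. -/
def gradVert (g : LorentzMetric E Q) (U : Q → ℝ) (u : TB E Q) : TTSp u :=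
  vertLift u (g.sharp u.proj (differential 𝓘(ℝ, E) U u.proj))

/-- The vertical lift `((i_T F)^♯)^∨`, where `F = dA` and `(i_T F)(u) = F(u, ·)`. -/
def forceVert (g : LorentzMetric E Q) (A : SmoothOneForm E Q) (u : TB E Q) : TTSp u :=
  vertLift u (g.sharp u.proj (extDerivOneForm 𝓘(ℝ, E) A.val u.proj u.snd))

/-- The lagrangian `L₁ = - m c √g(u,u) - (e/c) ⟨A, u⟩ - U`, meaningful on time-like vectors. -/
def lagrangian₁ (g : LorentzMetric E Q) (A : SmoothOneForm E Q) (U : Q → ℝ) (m e c : ℝ)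
    (u : TB E Q) : ℝ :=
  -(m * c * Real.sqrt (g.normSq u)) - e / c * A.val u.proj u.snd - U u.proj

/-- The lagrangian `L₂ = - (1/2) m g(u,u) - (e/c) ⟨A, u⟩ - U`. -/
def lagrangian₂ (g : LorentzMetric E Q) (A : SmoothOneForm E Q) (U : Q → ℝ) (m e c : ℝ)
    (u : TB E Q) : ℝ :=
  -(1 / 2 * m * g.normSq u) - e / c * A.val u.proj u.snd - U u.proj

/-- The constraint function `φ(u) = g(u,u) - c²`. -/
def constraint (g : LorentzMetric E Q) (c : ℝ) (u : TB E Q) : ℝ := g.normSq u - c ^ 2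

/-- `Σ = S_g - (e v / (m c²)) ((i_T F)^♯)^∨`. -/
def sigmaField (g : LorentzMetric E Q) (A : SmoothOneForm E Q) (m e c : ℝ) (u : TB E Q) : TTSp u :=
  g.geodesicField u - (e * g.speed u / (m * c ^ 2)) • g.forceVert A u

/-- `Y = (1/m) (grad U)^∨ - (1/(m c²)) (i_T dU) Δ`. -/
def verticalSolution (g : LorentzMetric E Q) (U : Q → ℝ) (m c : ℝ) (u : TB E Q) : TTSp u :=
  (1 / m) • g.gradVert U u
    - (1 / (m * c ^ 2) * differential 𝓘(ℝ, E) U u.proj u.snd) • liouville u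

/-- `X = S_g + (1/m) (grad U)^∨ - (e/(m c)) ((i_T F)^♯)^∨ - (1/(m c²)) (i_T dU) Δ`. -/
def solution (g : LorentzMetric E Q) (A : SmoothOneForm E Q) (U : Q → ℝ) (m e c : ℝ)
    (u : TB E Q) : TTSp u :=
  g.geodesicField u + (1 / m) • g.gradVert U u - (e / (m * c)) • g.forceVert A u
    - (1 / (m * c ^ 2) * differential 𝓘(ℝ, E) U u.proj u.snd) • liouville u

theorem flat_sharp (g : LorentzMetric E Q) (q : Q) (α : TSp E q →L[ℝ] ℝ) :
    g.val q (g.sharp q α) = α := by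
  obtain ⟨b, hb⟩ := g.signature q
  have key : ∀ (f : E →L[ℝ] E →L[ℝ] ℝ) (b : Module.Basis (Fin 4) ℝ E),
      (∀ i j, f (b i) (b j) = if i = j then (if i = 0 then 1 else -1) else 0) →
      ∀ α : E →L[ℝ] ℝ, f (f.inverse α) = α := by
    intro f b hb α
    have hinj : Function.Injective f := by
      refine (injective_iff_map_eq_zero f).2 fun v hv => ?_
      have hj : ∀ j, b.repr v j = 0 := by
        intro j
        have h1 : f v (b j) = 0 := by rw [hv]; rfl
        rw [← b.sum_repr v] at h1
        simp only [map_sum, map_smul, _root_.sum_apply,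
          _root_.smul_apply, hb, smul_eq_mul, mul_ite, mul_zero,
          Finset.sum_ite_eq', Finset.mem_univ, if_true] at h1
        split_ifs at h1 <;> simpa using h1
      exact b.repr.map_eq_zero_iff.1 (Finsupp.ext hj)
    have hfin : FiniteDimensional ℝ E := b.finiteDimensional_of_finite
    have hdim : Module.finrank ℝ E = Module.finrank ℝ (E →L[ℝ] ℝ) := by
      rw [← (LinearMap.toContinuousLinearMap (𝕜 := ℝ) (E := E) (F' := ℝ)).finrank_eq]
      exact (Subspace.dual_finrank_eq (K := ℝ) (V := E)).symm
    let e := (LinearEquiv.ofInjectiveOfFinrankEq f.toLinearMap hinj hdim).toContinuousLinearEquiv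
    have he : (e : E →L[ℝ] E →L[ℝ] ℝ) = f := by ext v w; rfl
    rw [← he, ContinuousLinearMap.inverse_equiv]
    exact e.apply_symm_apply α
  exact key (g.val q) b hb α

end LorentzMetric

end

/-! Along `M` one has `ᵗJ ∘ dφ = 2θ_g`, so the constraint forces at a point form the line spanned by
`θ_g` (`mem_constraintForces_iff`). The equation for a value `Z` at `u ∈ M` therefore reads:
`dE_g(Z) = 0` and `i_Z ω_L - dE_L = l θ_g` for some real `l`.

With `F = dA`, one finds `ω_{L₂} = -m ω_g + (e/c) τ*F` and `E_{L₂} = -m E_g + U`. For `L₁` the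
constant `-m` in front of `θ_g` becomes the function `-mc/v`, so `ω_{L₁} = -(mc/v) ω_g - (mc/v³)
dE_g ∧ θ_g + (e/c) τ*F`. Since `L₁ + U` is homogeneous of degree one in the velocity, `E_{L₁} = U`.

The decisive identity is `ω_g(ξ^∨, w) = -g(ξ, Tτ w)` (`twoForm_vertLift`), while `θ_g`, `τ*F` and
`τ*dU` vanish on vertical vectors. Testing the equation on vertical vectors thus determines `Tτ Z`.
For `L₂` it forces `Tτ Z = u`. For `L₁`, where `v = c` and `dE_g(Z) = 0`, it only forces `Tτ Z = μ
u` with `μ = θ_g(Z)/c²` free. What remains is one and the same equation, with `μ = 1` for `L₂`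
(`eq_verticalSolution_add_iff`): `Z - μ S_g` is a vertical lift `η^∨`, and `m g(η, ·) + μ (e/c) F(u,
·) - dU = l g(u, ·)`. Tangency means `g(u, η) = 0`, so evaluation at `u` gives `l = -dU(u)/c²`, and
nondegeneracy of `g` gives `η`. The result is `Z = Y + μ Σ`. Being second-order means `μ = 1`, and
`X = Y + Σ` on `M`.

Nondegeneracy of `ω_g` and `ω_{L₂}` also comes from their contractions with vertical vectors
(`injective_of_vertLift`); `ω_{L₁}` is degenerate because `i_Δ ω_{L₁} = 0`. The analytic input is
that `d` satisfies the Leibniz rule and commutes with pullbacks, and that all fields involved are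
smooth, by inverting the coordinate expressions of `g` and `ω_g`. -/

noncomputable section

open Filter Topology

set_option linter.unusedSectionVars false

/-! ### Calculus of the exterior derivative: Leibniz rule, pullbacks, independence of the chart. -/

section Forms

variable {E : Type*} [NormedAddCommGroup E] [NormedSpace ℝ E] {H : Type*} [TopologicalSpace H]
  {I : ModelWithCorners ℝ E H} [I.Boundaryless] {N : Type*} [TopologicalSpace N]
  [ChartedSpace H N] [IsManifold I ∞ N]
  {E' : Type*} [NormedAddCommGroup E'] [NormedSpace ℝ E'] {H' : Type*} [TopologicalSpace H']
  {I' : ModelWithCorners ℝ E' H'} [I'.Boundaryless] {N' : Type*} [TopologicalSpace N']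
  [ChartedSpace H' N'] [IsManifold I' ∞ N']

theorem contMDiffAt_extChartAt_symm_of_mem {x : N} {y : E} (hy : y ∈ (extChartAt I x).target) :
    ContMDiffAt 𝓘(ℝ, E) I ∞ (extChartAt I x).symm y :=
  (contMDiffOn_extChartAt_symm x).contMDiffAt ((isOpen_extChartAt_target x).mem_nhds hy)

theorem contMDiffAt_extChartAt_of_mem {x z : N} (hz : z ∈ (extChartAt I x).source) :
    ContMDiffAt I 𝓘(ℝ, E) ∞ (extChartAt I x) z :=
  contMDiffAt_extChartAt' (by rwa [← extChartAt_source (I := I)])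

theorem mdifferentiableAt_extChartAt_symm_of_mem {x : N} {y : E}
    (hy : y ∈ (extChartAt I x).target) :
    MDifferentiableAt 𝓘(ℝ, E) I (extChartAt I x).symm y :=
  (contMDiffAt_extChartAt_symm_of_mem hy).mdifferentiableAt (by simp)

theorem mdifferentiableAt_extChartAt_of_mem {x z : N} (hz : z ∈ (extChartAt I x).source) :
    MDifferentiableAt I 𝓘(ℝ, E) (extChartAt I x) z :=
  (contMDiffAt_extChartAt_of_mem hz).mdifferentiableAt (by simp)

theorem mfderiv_extChartAt_comp_symm {x : N} {y : E} (hy : y ∈ (extChartAt I x).target) (w : E) :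
    mfderiv I 𝓘(ℝ, E) (extChartAt I x) ((extChartAt I x).symm y)
      (mfderiv 𝓘(ℝ, E) I (extChartAt I x).symm y w) = w := by
  have := mfderiv_extChartAt_comp_mfderivWithin_extChartAt_symm (I := I) hy
  rw [I.range_eq_univ, mfderivWithin_univ] at this
  exact DFunLike.congr_fun this w

theorem mfderiv_extChartAt_symm_comp {x z : N} (hz : z ∈ (extChartAt I x).source)
    (w : TangentSpace I z) :
    (mfderiv 𝓘(ℝ, E) I (extChartAt I x).symm (extChartAt I x z)
      (mfderiv I 𝓘(ℝ, E) (extChartAt I x) z w) : E) = w := by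
  have := mfderivWithin_extChartAt_symm_comp_mfderiv_extChartAt' (I := I) hz
  rw [I.range_eq_univ, mfderivWithin_univ] at this
  exact DFunLike.congr_fun this w

theorem eventually_extChartAt_symm {p : N → Prop} {x : N} (h : ∀ᶠ z in 𝓝 x, p z) :
    ∀ᶠ y in 𝓝 (extChartAt I x x), p ((extChartAt I x).symm y) := by
  have := (continuousAt_extChartAt_symm (I := I) x)
  rw [ContinuousAt, extChartAt_to_inv] at this
  exact this.eventually h

theorem eventually_mem_extChartAt_target (x : N) :
    ∀ᶠ y in 𝓝 (extChartAt I x x), y ∈ (extChartAt I x).target :=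
  (isOpen_extChartAt_target x).mem_nhds (mem_extChartAt_target x)

/-- A 1-form is differentiable at `x` if its expression in the chart at `x` is. -/
def OneFormDifferentiableAt (I : ModelWithCorners ℝ E H) (θ : ∀ x : N, TangentSpace I x →L[ℝ] ℝ)
    (x : N) : Prop :=
  DifferentiableAt ℝ (oneFormInChart I θ x) (extChartAt I x x)

theorem oneFormInChart_eventuallyEq {θ θ' : ∀ x : N, TangentSpace I x →L[ℝ] ℝ} {x : N}
    (h : ∀ᶠ z in 𝓝 x, θ z = θ' z) :
    oneFormInChart I θ x =ᶠ[𝓝 (extChartAt I x x)] oneFormInChart I θ' x := by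
  filter_upwards [eventually_extChartAt_symm (I := I) h] with y hy
  simp only [oneFormInChart, hy]

theorem extDerivOneForm_congr {θ θ' : ∀ x : N, TangentSpace I x →L[ℝ] ℝ} {x : N}
    (h : ∀ᶠ z in 𝓝 x, θ z = θ' z) : extDerivOneForm I θ x = extDerivOneForm I θ' x := by
  simp only [extDerivOneForm, (oneFormInChart_eventuallyEq h).fderiv_eq]
  rfl

theorem extDerivOneForm_apply (θ : ∀ x : N, TangentSpace I x →L[ℝ] ℝ) (x : N)
    (w w' : TangentSpace I x) :
    extDerivOneForm I θ x w w' =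
      fderiv ℝ (oneFormInChart I θ x) (extChartAt I x x) w w' -
        fderiv ℝ (oneFormInChart I θ x) (extChartAt I x x) w' w := by
  have h : ∀ w : TangentSpace I x, (mfderiv I 𝓘(ℝ, E) (extChartAt I x) x w : E) = w := by
    intro w
    rw [mfderiv_extChartAt_self]; rfl
  change fderiv ℝ (oneFormInChart I θ x) (extChartAt I x x)
    (mfderiv I 𝓘(ℝ, E) (extChartAt I x) x w) (mfderiv I 𝓘(ℝ, E) (extChartAt I x) x w') -
    fderiv ℝ (oneFormInChart I θ x) (extChartAt I x x)
    (mfderiv I 𝓘(ℝ, E) (extChartAt I x) x w') (mfderiv I 𝓘(ℝ, E) (extChartAt I x) x w) = _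
  rw [h, h]

theorem extDerivOneForm_neg_swap (θ : ∀ x : N, TangentSpace I x →L[ℝ] ℝ) (x : N)
    (w w' : TangentSpace I x) :
    extDerivOneForm I θ x w w' = - extDerivOneForm I θ x w' w := by
  rw [extDerivOneForm_apply, extDerivOneForm_apply]; ring

theorem extDerivOneForm_add {θ θ' : ∀ x : N, TangentSpace I x →L[ℝ] ℝ} {x : N}
    (h : OneFormDifferentiableAt I θ x) (h' : OneFormDifferentiableAt I θ' x)
    (w w' : TangentSpace I x) :
    extDerivOneForm I (fun z => θ z + θ' z) x w w' =
      extDerivOneForm I θ x w w' + extDerivOneForm I θ' x w w' := by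
  have key : fderiv ℝ (oneFormInChart I (fun z => θ z + θ' z) x) (extChartAt I x x) =
      fderiv ℝ (oneFormInChart I θ x) (extChartAt I x x) +
      fderiv ℝ (oneFormInChart I θ' x) (extChartAt I x x) := fderiv_add h h'
  have alg : ∀ (B C D : E →L[ℝ] E →L[ℝ] ℝ) (_ : B = C + D) (w w' : E),
      B w w' - B w' w = (C w w' - C w' w) + (D w w' - D w' w) := by
    rintro _ C D rfl w w'
    simp only [add_apply]
    ring
  rw [extDerivOneForm_apply, extDerivOneForm_apply, extDerivOneForm_apply]
  exact alg _ _ _ key w w'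

/-- `α` and `β` are the values at `x` of `df` and `θ`, read as functionals on the fixed model space,
so that the product rule can be stated for maps on that space. -/
theorem oneFormInChart_smul_hasFDerivAt {f : N → ℝ} {θ : ∀ x : N, TangentSpace I x →L[ℝ] ℝ} {x : N}
    (hf : MDifferentiableAt I 𝓘(ℝ, ℝ) f x) (h : OneFormDifferentiableAt I θ x)
    {α β : E →L[ℝ] ℝ} (hα : α = differential I f x) (hβ : β = θ x) :
    HasFDerivAt (oneFormInChart I (fun z => f z • θ z) x)
      (f x • fderiv ℝ (oneFormInChart I θ x) (extChartAt I x x) +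
        α.smulRight β) (extChartAt I x x) := by
  have h1 : HasFDerivAt (f ∘ (extChartAt I x).symm) α (extChartAt I x x) := by
    rw [hα]
    have := hf.hasMFDerivAt.2
    rw [I.range_eq_univ] at this
    exact hasFDerivWithinAt_univ.1 this
  have h2 := h1.smul (DifferentiableAt.hasFDerivAt h)
  have e1 : oneFormInChart I θ x (extChartAt I x x) = β := by
    rw [hβ]
    -- The base point is `x` only up to a propositional equality. All tangent spaces being the model
    -- space, point and vectors are replaced together.
    have h3 : ∀ (y : N), y = x → ∀ v w : E, v = w →
        (θ y : E →L[ℝ] ℝ) v = (θ x : E →L[ℝ] ℝ) w := by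
      rintro y rfl v w rfl; rfl
    ext v
    refine h3 _ (extChartAt_to_inv (I := I) x) _ _ ?_
    have := mfderivWithin_range_extChartAt_symm (I := I) (x := x)
    rw [I.range_eq_univ, mfderivWithin_univ] at this
    rw [this]; rfl
  rw [e1] at h2
  simp only [Function.comp_apply, extChartAt_to_inv] at h2
  exact h2

theorem OneFormDifferentiableAt.smul {f : N → ℝ} {θ : ∀ x : N, TangentSpace I x →L[ℝ] ℝ} {x : N}
    (hf : MDifferentiableAt I 𝓘(ℝ, ℝ) f x) (h : OneFormDifferentiableAt I θ x) :
    OneFormDifferentiableAt I (fun z => f z • θ z) x :=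
  (oneFormInChart_smul_hasFDerivAt hf h rfl rfl).differentiableAt

theorem extDerivOneForm_smul {f : N → ℝ} {θ : ∀ x : N, TangentSpace I x →L[ℝ] ℝ} {x : N}
    (hf : MDifferentiableAt I 𝓘(ℝ, ℝ) f x) (h : OneFormDifferentiableAt I θ x)
    (w w' : TangentSpace I x) :
    extDerivOneForm I (fun z => f z • θ z) x w w' =
      f x * extDerivOneForm I θ x w w' +
        (differential I f x w * θ x w' - differential I f x w' * θ x w) := by
  have alg : ∀ (B C : E →L[ℝ] E →L[ℝ] ℝ) (r : ℝ) (α β : E →L[ℝ] ℝ)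
      (_ : B = r • C + α.smulRight β) (w w' : E),
      B w w' - B w' w = r * (C w w' - C w' w) + (α w * β w' - α w' * β w) := by
    rintro _ C r α β rfl w w'
    simp only [add_apply, smul_apply, ContinuousLinearMap.smulRight_apply, smul_eq_mul]
    ring
  rw [extDerivOneForm_apply, extDerivOneForm_apply]
  exact alg _ _ _ _ _ (oneFormInChart_smul_hasFDerivAt hf h rfl rfl).fderiv w w'

/-- The pullback of a 1-form by a map. -/
def oneFormPullback (I : ModelWithCorners ℝ E H) (I' : ModelWithCorners ℝ E' H')
    (f : N → N') (θ : ∀ x : N', TangentSpace I' x →L[ℝ] ℝ) (x : N) : TangentSpace I x →L[ℝ] ℝ :=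
  (θ (f x)).comp (mfderiv I I' f x)

/-- With `F` the expression of `f` in charts, `κ'⁻¹ ∘ F = f ∘ κ⁻¹` near each point considered;
differentiating this shows that pulling back commutes with passing to local expressions. -/
theorem oneFormInChart_pullback_eventuallyEq {f : N → N'} {x : N} (hf : ContMDiffAt I I' ∞ f x)
    (θ : ∀ x : N', TangentSpace I' x →L[ℝ] ℝ) :
    oneFormInChart I (oneFormPullback I I' f θ) x =ᶠ[𝓝 (extChartAt I x x)]
      fun y => (oneFormInChart I' θ (f x) (writtenInExtChartAt I I' x f y)).comp
        (fderiv ℝ (writtenInExtChartAt I I' x f) y) := by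
  have h1 : ∀ᶠ z in 𝓝 x, MDifferentiableAt I I' f z ∧ f z ∈ (extChartAt I' (f x)).source := by
    refine (((contMDiffAt_iff_contMDiffAt_nhds (by simp)).1 (hf.of_le (m := 1) (by simp))).mono
      (fun z hz => hz.mdifferentiableAt (by simp))).and ?_
    exact hf.continuousAt.eventually (extChartAt_source_mem_nhds (f x))
  filter_upwards [eventually_extChartAt_symm (I := I) h1, eventually_mem_extChartAt_target x]
    with y ⟨hy1, hy2⟩ hy3
  set κ := extChartAt I x
  set κ' := extChartAt I' (f x)
  have hκ := mdifferentiableAt_extChartAt_symm_of_mem hy3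
  have h2 : HasMFDerivAt 𝓘(ℝ, E) I' (f ∘ κ.symm) y
      ((mfderiv I I' f (κ.symm y)).comp (mfderiv 𝓘(ℝ, E) I κ.symm y)) :=
    hy1.hasMFDerivAt.comp y hκ.hasMFDerivAt
  have h3' : MDifferentiableAt 𝓘(ℝ, E) 𝓘(ℝ, E') (writtenInExtChartAt I I' x f) y :=
    (mdifferentiableAt_extChartAt_of_mem hy2).comp y h2.mdifferentiableAt
  have h3d : DifferentiableAt ℝ (writtenInExtChartAt I I' x f) y := h3'.differentiableAt
  have h3 := h3d.hasFDerivAt.hasMFDerivAt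
  have hz : κ' (f (κ.symm y)) ∈ κ'.target := κ'.map_source hy2
  have h4 :=
    HasMFDerivAt.comp y (mdifferentiableAt_extChartAt_symm_of_mem hz).hasMFDerivAt h3
  have h5 : κ'.symm ∘ writtenInExtChartAt I I' x f =ᶠ[𝓝 y] f ∘ κ.symm := by
    filter_upwards [h2.mdifferentiableAt.continuousAt.eventually
      ((isOpen_extChartAt_source (I := I') (f x)).mem_nhds hy2)] with y' hy'
    exact κ'.left_inv hy'
  have h6 := hasMFDerivAt_unique (h4.congr_of_eventuallyEq h5.symm) h2
  have h7 : κ'.symm (κ' (f (κ.symm y))) = f (κ.symm y) := κ'.left_inv hy2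
  have h8 : ∀ p q : N', p = q → ∀ v w : E', v = w → (θ p : E' →L[ℝ] ℝ) v = (θ q : E' →L[ℝ] ℝ) w := by
    rintro p _ rfl v _ rfl; rfl
  ext w
  exact (h8 _ _ h7 _ _ ((congrArg (fun T => T w) h6))).symm

theorem contDiffAt_writtenInExtChartAt {f : N → N'} {x : N} (hf : ContMDiffAt I I' ∞ f x) :
    ContDiffAt ℝ ∞ (writtenInExtChartAt I I' x f) (extChartAt I x x) := by
  have := (contMDiffAt_iff.1 hf).2
  rw [I.range_eq_univ, contDiffWithinAt_univ] at this
  exact this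

theorem hasFDerivAt_comp_clm_comp_fderiv {F : E → E'} {F' : E → E →L[ℝ] E'} {a : E' → E' →L[ℝ] ℝ}
    {a' : E' →L[ℝ] E' →L[ℝ] ℝ} {L : E →L[ℝ] E'} {F'' : E →L[ℝ] E →L[ℝ] E'} {y : E}
    (ha : HasFDerivAt a a' (F y)) (hF : HasFDerivAt F L y) (hF' : HasFDerivAt F' F'' y) :
    HasFDerivAt (fun y => (a (F y)).comp (F' y))
      ((ContinuousLinearMap.compL ℝ E E' ℝ (a (F y))).comp F'' +
        ((ContinuousLinearMap.compL ℝ E E' ℝ).flip (F' y)).comp (a'.comp L)) y := by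
  have h : HasFDerivAt (fun y => a (F y)) (a'.comp L) y := ha.comp y hF
  exact h.clm_comp hF'

/-- The product rule for `a(F y) ∘ DF(y)` isolates the term in the second derivative of `F`, the
only one that is not a pullback. -/
theorem oneFormInChart_pullback_hasFDerivAt {f : N → N'} {x : N} (hf : ContMDiffAt I I' ∞ f x)
    {θ : ∀ x : N', TangentSpace I' x →L[ℝ] ℝ} (h : OneFormDifferentiableAt I' θ (f x)) :
    DifferentiableAt ℝ (oneFormInChart I (oneFormPullback I I' f θ) x) (extChartAt I x x) ∧
    ∀ w w' : E, fderiv ℝ (oneFormInChart I (oneFormPullback I I' f θ) x) (extChartAt I x x) w w' =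
      oneFormInChart I' θ (f x) (extChartAt I' (f x) (f x))
        (fderiv ℝ (fderiv ℝ (writtenInExtChartAt I I' x f)) (extChartAt I x x) w w') +
      fderiv ℝ (oneFormInChart I' θ (f x)) (extChartAt I' (f x) (f x))
        (fderiv ℝ (writtenInExtChartAt I I' x f) (extChartAt I x x) w)
        (fderiv ℝ (writtenInExtChartAt I I' x f) (extChartAt I x x) w') := by
  have hF := contDiffAt_writtenInExtChartAt hf
  have hF1 : HasFDerivAt (writtenInExtChartAt I I' x f) _ (extChartAt I x x) :=
    (hF.differentiableAt (by simp)).hasFDerivAt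
  have hF2 : HasFDerivAt (fderiv ℝ (writtenInExtChartAt I I' x f)) _ (extChartAt I x x) :=
    ((hF.fderiv_right (m := 1) (by norm_num; exact WithTop.coe_le_coe.2 le_top)).differentiableAt
      (by simp)).hasFDerivAt
  have e : writtenInExtChartAt I I' x f (extChartAt I x x) = extChartAt I' (f x) (f x) := by
    simp [writtenInExtChartAt]
  have hθ : HasFDerivAt (oneFormInChart I' θ (f x))
      (fderiv ℝ (oneFormInChart I' θ (f x)) (extChartAt I' (f x) (f x)))
      (writtenInExtChartAt I I' x f (extChartAt I x x)) := by
    rw [e]; exact DifferentiableAt.hasFDerivAt h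
  have h1 := hasFDerivAt_comp_clm_comp_fderiv hθ hF1 hF2
  have h2 := h1.congr_of_eventuallyEq (oneFormInChart_pullback_eventuallyEq hf θ)
  refine ⟨h2.differentiableAt, fun w w' => ?_⟩
  rw [h2.fderiv, e]
  rfl

theorem OneFormDifferentiableAt.pullback {f : N → N'} {x : N} (hf : ContMDiffAt I I' ∞ f x)
    {θ : ∀ x : N', TangentSpace I' x →L[ℝ] ℝ} (h : OneFormDifferentiableAt I' θ (f x)) :
    OneFormDifferentiableAt I (oneFormPullback I I' f θ) x :=
  (oneFormInChart_pullback_hasFDerivAt hf h).1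

/-- The exterior derivative commutes with pullbacks. -/
theorem extDerivOneForm_pullback {f : N → N'} {x : N} (hf : ContMDiffAt I I' ∞ f x)
    {θ : ∀ x : N', TangentSpace I' x →L[ℝ] ℝ} (h : OneFormDifferentiableAt I' θ (f x))
    (w w' : TangentSpace I x) :
    extDerivOneForm I (oneFormPullback I I' f θ) x w w' =
      extDerivOneForm I' θ (f x) (mfderiv I I' f x w) (mfderiv I I' f x w') := by
  have h1 := (oneFormInChart_pullback_hasFDerivAt hf h).2
  -- Symmetry of the second derivative makes its two contributions cancel in the antisymmetrization.
  have h2 : IsSymmSndFDerivAt ℝ (writtenInExtChartAt I I' x f) (extChartAt I x x) :=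
    (contDiffAt_writtenInExtChartAt hf).isSymmSndFDerivAt
      (by simpa using WithTop.coe_le_coe.2 (le_top : (2 : ℕ∞) ≤ ⊤))
  have h3 : ∀ w : E, (mfderiv I I' f x w : E') =
      fderiv ℝ (writtenInExtChartAt I I' x f) (extChartAt I x x) w := by
    intro w
    have h4 := (hf.mdifferentiableAt (by simp)).mfderiv
    rw [I.range_eq_univ, fderivWithin_univ] at h4
    rw [h4]
    rfl
  rw [extDerivOneForm_apply, extDerivOneForm_apply]
  refine (congrArg₂ (· - ·) (h1 w w') (h1 w' w)).trans ?_
  have h5 := h2 w w'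
  have h6 := h3 w
  have h7 := h3 w'
  have alg : ∀ (B : E' →L[ℝ] E' →L[ℝ] ℝ) (a : E' →L[ℝ] ℝ) (s t v v' u u' : E'), s = t → u = v →
      u' = v' → (a s + B v v') - (a t + B v' v) = B u u' - B u' u := by
    rintro B a s _ v v' _ _ rfl rfl rfl
    ring
  exact alg _ _ _ _ _ _ _ _ h5 h6 h7

theorem oneFormInChart_modelWithCornersSelf (a : ∀ y : E, TangentSpace 𝓘(ℝ, E) y →L[ℝ] ℝ)
    (x : E) : oneFormInChart 𝓘(ℝ, E) a x = a := by
  have h : (mfderiv 𝓘(ℝ, E) 𝓘(ℝ, E) (id : E → E)) = fun _ => ContinuousLinearMap.id ℝ E :=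
    funext fun _ => mfderiv_id
  ext y w
  change a y (mfderiv 𝓘(ℝ, E) 𝓘(ℝ, E) (extChartAt 𝓘(ℝ, E) x).symm y w) = a y w
  have h1 : ((extChartAt 𝓘(ℝ, E) x).symm : E → E) = id := rfl
  rw [h1, h]
  rfl

/-- The exterior derivative of a 1-form, computed in any chart. -/
theorem extDerivOneForm_eq_of_mem_source (θ : ∀ x : N, TangentSpace I x →L[ℝ] ℝ) {x₀ x : N}
    (hx : x ∈ (extChartAt I x₀).source)
    (h : DifferentiableAt ℝ (oneFormInChart I θ x₀) (extChartAt I x₀ x)) {κ : E →L[ℝ] E}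
    (hκ : κ = mfderiv I 𝓘(ℝ, E) (extChartAt I x₀) x) (w w' : E) :
    extDerivOneForm I θ x w w' =
      fderiv ℝ (oneFormInChart I θ x₀) (extChartAt I x₀ x) (κ w) (κ w') -
        fderiv ℝ (oneFormInChart I θ x₀) (extChartAt I x₀ x) (κ w') (κ w) := by
  obtain ⟨a, ha⟩ : ∃ a : ∀ y : E, TangentSpace 𝓘(ℝ, E) y →L[ℝ] ℝ, a = oneFormInChart I θ x₀ :=
    ⟨_, rfl⟩
  -- Near `x` the form is the pullback, by the chart at `x₀`, of its own local expression, so the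
  -- claim is a case of naturality under pullback.
  have h1 : ∀ᶠ z in 𝓝 x, θ z = oneFormPullback I 𝓘(ℝ, E) (extChartAt I x₀) a z := by
    filter_upwards [(isOpen_extChartAt_source (I := I) x₀).mem_nhds hx] with z hz
    have h8 : ∀ p q : N, p = q → ∀ v w : E, v = w →
      (θ p : E →L[ℝ] ℝ) v = (θ q : E →L[ℝ] ℝ) w := by
      rintro p _ rfl v _ rfl; rfl
    ext w
    rw [oneFormPullback, ha]
    exact h8 _ _ ((extChartAt I x₀).left_inv hz).symm _ _ (mfderiv_extChartAt_symm_comp hz w).symm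
  have h2 : extChartAt 𝓘(ℝ, E) (extChartAt I x₀ x) (extChartAt I x₀ x) = extChartAt I x₀ x :=
    rfl
  have h3 : OneFormDifferentiableAt 𝓘(ℝ, E) a (extChartAt I x₀ x) := by
    unfold OneFormDifferentiableAt
    rw [oneFormInChart_modelWithCornersSelf, h2, ha]
    exact h
  rw [extDerivOneForm_congr h1]
  refine (extDerivOneForm_pullback (contMDiffAt_extChartAt_of_mem hx) h3 w w').trans ?_
  rw [extDerivOneForm_apply, oneFormInChart_modelWithCornersSelf, h2, ha, hκ]
  rfl

end Forms

/-! ### Charts of `TQ` induced by charts of `Q`; vertical vectors and the projection in these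
charts. -/

section TangentCharts

variable {E : Type*} [NormedAddCommGroup E] [NormedSpace ℝ E]
  {Q : Type*} [TopologicalSpace Q] [ChartedSpace E Q] [IsManifold 𝓘(ℝ, E) ∞ Q]

variable (E) in
/-- The derivative at `q` of the chart at `q₀`, as an endomorphism of the model space. -/
def chartDeriv (q₀ q : Q) : E →L[ℝ] E :=
  mfderiv 𝓘(ℝ, E) 𝓘(ℝ, E) (extChartAt 𝓘(ℝ, E) q₀) q

variable (E) in
/-- The derivative at `y` of the inverse of the chart at `q₀`. -/
def chartDerivSymm (q₀ : Q) (y : E) : E →L[ℝ] E :=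
  mfderiv 𝓘(ℝ, E) 𝓘(ℝ, E) (extChartAt 𝓘(ℝ, E) q₀).symm y

/-- The derivative at `u` of the chart of `TQ` at `u₀`. -/
def tangentChartDeriv (u₀ u : TB E Q) : E × E →L[ℝ] E × E :=
  mfderiv (𝓘(ℝ, E)).tangent 𝓘(ℝ, E × E) (extChartAt (𝓘(ℝ, E)).tangent u₀) u

/-- The derivative at `z` of the inverse of the chart of `TQ` at `u₀`. -/
def tangentChartDerivSymm (u₀ : TB E Q) (z : E × E) : E × E →L[ℝ] E × E :=
  mfderiv 𝓘(ℝ, E × E) (𝓘(ℝ, E)).tangent (extChartAt (𝓘(ℝ, E)).tangent u₀).symm z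

theorem chartDeriv_chartDerivSymm {q₀ : Q} {y : E} (hy : y ∈ (extChartAt 𝓘(ℝ, E) q₀).target)
    (w : E) : chartDeriv E q₀ ((extChartAt 𝓘(ℝ, E) q₀).symm y) (chartDerivSymm E q₀ y w) = w :=
  mfderiv_extChartAt_comp_symm hy w

theorem chartDerivSymm_chartDeriv {q₀ q : Q} (hq : q ∈ (extChartAt 𝓘(ℝ, E) q₀).source)
    (w : E) : chartDerivSymm E q₀ (extChartAt 𝓘(ℝ, E) q₀ q) (chartDeriv E q₀ q w) = w :=
  mfderiv_extChartAt_symm_comp hq w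

theorem tangentChartDeriv_symm {u₀ : TB E Q} {z : E × E}
    (hz : z ∈ (extChartAt (𝓘(ℝ, E)).tangent u₀).target) (w : E × E) :
    tangentChartDeriv u₀ ((extChartAt (𝓘(ℝ, E)).tangent u₀).symm z)
      (tangentChartDerivSymm u₀ z w) = w :=
  mfderiv_extChartAt_comp_symm (I := (𝓘(ℝ, E)).tangent) hz w

theorem tangentChartDerivSymm_deriv {u₀ u : TB E Q}
    (hu : u ∈ (extChartAt (𝓘(ℝ, E)).tangent u₀).source) (w : E × E) :
    tangentChartDerivSymm u₀ (extChartAt (𝓘(ℝ, E)).tangent u₀ u) (tangentChartDeriv u₀ u w) = w :=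
  mfderiv_extChartAt_symm_comp (I := (𝓘(ℝ, E)).tangent) hu w

theorem chartDeriv_self (q : Q) : chartDeriv E q q = ContinuousLinearMap.id ℝ E :=
  mfderiv_extChartAt_self

theorem mem_tangentChart_source {u₀ u : TB E Q} :
    u ∈ (extChartAt (𝓘(ℝ, E)).tangent u₀).source ↔
      u.proj ∈ (extChartAt 𝓘(ℝ, E) u₀.proj).source := by
  simp

theorem mem_tangentChart_target {u₀ : TB E Q} {z : E × E} :
    z ∈ (extChartAt (𝓘(ℝ, E)).tangent u₀).target ↔
      z.1 ∈ (extChartAt 𝓘(ℝ, E) u₀.proj).target := by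
  rw [ModelWithCorners.tangent, FiberBundle.extChartAt_target]
  simp +contextual

/-- The trivialization of `TQ` over the chart at `u₀.proj` acts on fibres by the derivative of that
chart. -/
theorem tangentChart_apply {u₀ u : TB E Q} (hu : u.proj ∈ (extChartAt 𝓘(ℝ, E) u₀.proj).source) :
    extChartAt (𝓘(ℝ, E)).tangent u₀ u =
      (extChartAt 𝓘(ℝ, E) u₀.proj u.proj, chartDeriv E u₀.proj u.proj u.snd) := by
  have hu' : u.proj ∈ (chartAt E u₀.proj).source := by simpa using hu
  have h := TangentBundle.continuousLinearMapAt_trivializationAt (I := 𝓘(ℝ, E)) hu'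
  have h2 : (trivializationAt E (TangentSpace 𝓘(ℝ, E)) u₀.proj u).2 =
      (trivializationAt E (TangentSpace 𝓘(ℝ, E)) u₀.proj).continuousLinearMapAt ℝ u.proj u.snd := by
    rw [Bundle.Trivialization.continuousLinearMapAt_apply,
      Bundle.Trivialization.coe_linearMapAt_of_mem _ (by simpa using hu')]
  rw [h] at h2
  exact Prod.ext rfl h2

theorem tangentChart_symm_snd {u₀ : TB E Q} {z : E × E}
    (hz : z.1 ∈ (extChartAt 𝓘(ℝ, E) u₀.proj).target) :
    (((extChartAt (𝓘(ℝ, E)).tangent u₀).symm z).snd : E) = chartDerivSymm E u₀.proj z.1 z.2 := by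
  have h1 := (extChartAt 𝓘(ℝ, E) u₀.proj).map_target hz
  have h := tangentChart_apply (u₀ := u₀) (u := (extChartAt (𝓘(ℝ, E)).tangent u₀).symm z) h1
  rw [(extChartAt (𝓘(ℝ, E)).tangent u₀).right_inv (mem_tangentChart_target.2 hz)] at h
  have h2 := congrArg Prod.snd h
  have h3 := chartDerivSymm_chartDeriv h1
    ((extChartAt (𝓘(ℝ, E)).tangent u₀).symm z).snd
  rw [(extChartAt 𝓘(ℝ, E) u₀.proj).right_inv hz] at h3
  rw [h2]
  exact h3.symm

theorem contMDiff_tangentProj :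
    ContMDiff (𝓘(ℝ, E)).tangent 𝓘(ℝ, E) ∞ (Bundle.TotalSpace.proj : TB E Q → Q) :=
  Bundle.contMDiff_proj _

/-- Both sides differentiate the same map: the chart of `Q` after `τ_Q` is the first component of
the chart of `TQ`. -/
theorem chartDeriv_dproj {u₀ u : TB E Q} (hu : u.proj ∈ (extChartAt 𝓘(ℝ, E) u₀.proj).source)
    (w : TTSp u) : chartDeriv E u₀.proj u.proj (dproj u w) = (tangentChartDeriv u₀ u w).1 := by
  have hu' := mem_tangentChart_source.2 hu
  have h1 := (mdifferentiableAt_extChartAt_of_mem hu).hasMFDerivAt.comp u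
    (contMDiff_tangentProj.mdifferentiableAt (by simp)).hasMFDerivAt
  have h2 := (ContinuousLinearMap.fst ℝ E E).hasMFDerivAt.comp u
    (mdifferentiableAt_extChartAt_of_mem hu').hasMFDerivAt
  exact DFunLike.congr_fun (hasMFDerivAt_unique h1 h2) w

/-- The inclusion of a fibre in the tangent bundle. -/
def fibreInclusion (q : Q) (ξ : E) : TB E Q :=
  Bundle.TotalSpace.mk' E (E := (TangentSpace 𝓘(ℝ, E) : Q → Type _)) q ξ

theorem contMDiff_fibreInclusion (q : Q) :
    ContMDiff 𝓘(ℝ, E) (𝓘(ℝ, E)).tangent ∞ (fibreInclusion (E := E) q) := by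
  intro ξ
  refine Bundle.contMDiffAt_totalSpace.2 ⟨contMDiffAt_const, ?_⟩
  have h : (fun η : E => (trivializationAt E (TangentSpace 𝓘(ℝ, E)) q
      (fibreInclusion (E := E) q η)).2) =
      (trivializationAt E (TangentSpace 𝓘(ℝ, E)) q).continuousLinearMapAt ℝ q := by
    ext η
    rw [Bundle.Trivialization.continuousLinearMapAt_apply,
      Bundle.Trivialization.coe_linearMapAt_of_mem _ (by simp), fibreInclusion]
  change ContMDiffAt 𝓘(ℝ, E) 𝓘(ℝ, E) ∞ (fun η : E => (trivializationAt E (TangentSpace 𝓘(ℝ, E)) q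
      (fibreInclusion (E := E) q η)).2) ξ
  rw [h]
  exact (ContinuousLinearMap.contMDiff (E := E) (F := E) _).contMDiffAt

theorem hasMFDerivAt_fibreInclusion (q : Q) (ξ : E) :
    HasMFDerivAt 𝓘(ℝ, E) (𝓘(ℝ, E)).tangent (fibreInclusion q) ξ (vertLift (fibreInclusion q ξ)) :=
  ((contMDiff_fibreInclusion q).mdifferentiableAt (by simp)).hasMFDerivAt

/-- In the chart the fibre inclusion has constant first component and linear second component. -/
theorem tangentChartDeriv_vertLift {u₀ u : TB E Q}
    (hu : u.proj ∈ (extChartAt 𝓘(ℝ, E) u₀.proj).source) (ξ : TSp E u.proj) :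
    tangentChartDeriv u₀ u (vertLift u ξ) = (0, chartDeriv E u₀.proj u.proj ξ) := by
  have key : ∀ (q : Q) (v ξ : E), q ∈ (extChartAt 𝓘(ℝ, E) u₀.proj).source →
      tangentChartDeriv u₀ (fibreInclusion q v) (vertLift (fibreInclusion q v) ξ) =
        (0, chartDeriv E u₀.proj q ξ) := by
    intro q v ξ hq
    have h0 : fibreInclusion q v ∈ (extChartAt (𝓘(ℝ, E)).tangent u₀).source :=
      mem_tangentChart_source.2 hq
    have h1 := (mdifferentiableAt_extChartAt_of_mem h0).hasMFDerivAt.comp v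
      (hasMFDerivAt_fibreInclusion q v)
    have h2 : HasFDerivAt (fun η : E => (extChartAt 𝓘(ℝ, E) u₀.proj q,
        chartDeriv E u₀.proj q η)) ((0 : E →L[ℝ] E).prod (chartDeriv E u₀.proj q)) v :=
      (hasFDerivAt_const _ _).prodMk (chartDeriv E u₀.proj q).hasFDerivAt
    have h3 : (extChartAt (𝓘(ℝ, E)).tangent u₀) ∘ fibreInclusion q =
        fun η : E => (extChartAt 𝓘(ℝ, E) u₀.proj q, chartDeriv E u₀.proj q η) :=
      funext fun η => tangentChart_apply (u := fibreInclusion q η) hq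
    rw [h3] at h1
    exact DFunLike.congr_fun (hasMFDerivAt_unique h1 h2.hasMFDerivAt) ξ
  exact key u.proj u.snd ξ hu

/-- The derivative along a vertical lift is the derivative along the fibre. -/
theorem differential_vertLift {L : TB E Q → ℝ} {u : TB E Q}
    (hL : MDifferentiableAt (𝓘(ℝ, E)).tangent 𝓘(ℝ, ℝ) L u) {l : E →L[ℝ] ℝ}
    (hl : HasFDerivAt (fun η : E => L (fibreInclusion u.proj η)) l (u.snd : E))
    (ξ : TSp E u.proj) :
    differential (𝓘(ℝ, E)).tangent L u (vertLift u ξ) = l ξ := by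
  have key : ∀ (q : Q) (v : E),
      MDifferentiableAt (𝓘(ℝ, E)).tangent 𝓘(ℝ, ℝ) L (fibreInclusion q v) →
      HasFDerivAt (fun η : E => L (fibreInclusion q η)) l v → ∀ ξ : E,
      differential (𝓘(ℝ, E)).tangent L (fibreInclusion q v) (vertLift (fibreInclusion q v) ξ) =
        l ξ := by
    intro q v hL hl ξ
    have h2 := hL.hasMFDerivAt.comp v (hasMFDerivAt_fibreInclusion q v)
    exact DFunLike.congr_fun (hasMFDerivAt_unique h2 hl.hasMFDerivAt) ξ
  exact key u.proj u.snd hL hl ξ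

theorem dproj_vertLift (u : TB E Q) (ξ : TSp E u.proj) : dproj u (vertLift u ξ) = 0 := by
  have h := chartDeriv_dproj (mem_extChartAt_source u.proj) (vertLift u ξ)
  rw [tangentChartDeriv_vertLift (mem_extChartAt_source u.proj), chartDeriv_self] at h
  exact h

theorem vertLift_injective (u : TB E Q) : Function.Injective (vertLift u) := by
  intro ξ η h
  have h1 := tangentChartDeriv_vertLift (mem_extChartAt_source u.proj) ξ
  rw [h, tangentChartDeriv_vertLift (mem_extChartAt_source u.proj), chartDeriv_self] at h1
  exact (congrArg Prod.snd h1).symm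

theorem tangentChartDeriv_injective {u₀ u : TB E Q}
    (hu : u ∈ (extChartAt (𝓘(ℝ, E)).tangent u₀).source) :
    Function.Injective (tangentChartDeriv u₀ u) :=
  Function.LeftInverse.injective (tangentChartDerivSymm_deriv hu)

/-- Together with `dproj_vertLift`, `vertLift_injective` and `dproj_surjective` this is exactness of
`0 → T_qQ → T_u(TQ) → T_qQ → 0`. -/
theorem exists_eq_vertLift {u : TB E Q} {w : TTSp u} (hw : dproj u w = 0) :
    ∃ ξ, w = vertLift u ξ := by
  have h := mem_extChartAt_source (I := 𝓘(ℝ, E)) u.proj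
  obtain ⟨ξ, hξ⟩ : ∃ ξ, ξ = (tangentChartDeriv u u w).2 := ⟨_, rfl⟩
  refine ⟨ξ, tangentChartDeriv_injective (mem_tangentChart_source.2 h) ?_⟩
  refine Eq.trans ?_ (tangentChartDeriv_vertLift h ξ).symm
  rw [chartDeriv_self]
  refine Prod.ext ?_ hξ.symm
  rw [← chartDeriv_dproj h, hw]
  exact map_zero (chartDeriv E u.proj u.proj)

theorem dproj_surjective (u : TB E Q) : Function.Surjective (dproj u) := by
  intro ξ
  have h := mem_extChartAt_source (I := 𝓘(ℝ, E)) u.proj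
  have h1 := chartDeriv_dproj h
    (tangentChartDerivSymm u (extChartAt (𝓘(ℝ, E)).tangent u u) ((ξ, 0) : E × E))
  have h2 := tangentChartDeriv_symm (mem_extChartAt_target (I := (𝓘(ℝ, E)).tangent) u)
    ((ξ, 0) : E × E)
  rw [extChartAt_to_inv] at h2
  rw [h2, chartDeriv_self] at h1
  exact ⟨_, h1⟩

/-- The trivialization of `T(TQ)` at `u₀` is the derivative of the chart at `u₀`, so smoothness can
be tested on components in one fixed chart. -/
theorem contMDiffWithinAt_field_iff {X : ∀ u : TB E Q, TTSp u} {s : Set (TB E Q)} {u₀ : TB E Q} :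
    ContMDiffWithinAt (𝓘(ℝ, E)).tangent (𝓘(ℝ, E)).tangent.tangent ∞
      (fun u : TB E Q => (⟨u, X u⟩ : TangentBundle (𝓘(ℝ, E)).tangent (TB E Q))) s u₀ ↔
    ContMDiffWithinAt (𝓘(ℝ, E)).tangent 𝓘(ℝ, E × E) ∞
      (fun u => tangentChartDeriv u₀ u (X u)) s u₀ := by
  have h0 : ∀ u : TB E Q, u ∈ (extChartAt (𝓘(ℝ, E)).tangent u₀).source →
      tangentChartDeriv u₀ u (X u) =
      (trivializationAt (E × E) (TangentSpace (𝓘(ℝ, E)).tangent) u₀ ⟨u, X u⟩).2 := by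
    intro u hu
    have hu' : u ∈ (chartAt (ModelProd E E) u₀).source := by
      rwa [← extChartAt_source (I := (𝓘(ℝ, E)).tangent)]
    have h2 : (trivializationAt (E × E) (TangentSpace (𝓘(ℝ, E)).tangent) u₀ ⟨u, X u⟩).2 =
        (trivializationAt (E × E) (TangentSpace (𝓘(ℝ, E)).tangent) u₀).continuousLinearMapAt
          ℝ u (X u) := by
      rw [Bundle.Trivialization.continuousLinearMapAt_apply,
        Bundle.Trivialization.coe_linearMapAt_of_mem _ hu']
    rw [h2, TangentBundle.continuousLinearMapAt_trivializationAt hu']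
    rfl
  refine (Bundle.contMDiffWithinAt_section (F := E × E)
    (E := (TangentSpace (𝓘(ℝ, E)).tangent : TB E Q → Type _)) ).trans ?_
  refine Filter.EventuallyEq.contMDiffWithinAt_iff ?_ ?_
  · filter_upwards [mem_nhdsWithin_of_mem_nhds ((isOpen_extChartAt_source
      (I := (𝓘(ℝ, E)).tangent) u₀).mem_nhds (mem_extChartAt_source u₀))] with u hu
    exact (h0 u hu).symm
  · exact (h0 u₀ (mem_extChartAt_source u₀)).symm

end TangentCharts

/-! ### Smoothness of the coordinate expressions of the metric and of 1-forms. -/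

section LocalExpressions

variable {E : Type*} [NormedAddCommGroup E] [NormedSpace ℝ E]
  {Q : Type*} [TopologicalSpace Q] [ChartedSpace E Q] [IsManifold 𝓘(ℝ, E) ∞ Q]

theorem trivializationAt_symmL_eq {q₀ q : Q} (hq : q ∈ (extChartAt 𝓘(ℝ, E) q₀).source) :
    (trivializationAt E (TangentSpace 𝓘(ℝ, E)) q₀).symmL ℝ q =
      chartDerivSymm E q₀ (extChartAt 𝓘(ℝ, E) q₀ q) := by
  have hq' : q ∈ (chartAt E q₀).source := by simpa using hq
  have h := TangentBundle.symmL_trivializationAt (I := 𝓘(ℝ, E)) hq'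
  rw [ModelWithCorners.range_eq_univ, mfderivWithin_univ] at h
  exact h

theorem trivializationAt_cotangent_apply {q₀ q : Q} (hq : q ∈ (extChartAt 𝓘(ℝ, E) q₀).source)
    (α : E →L[ℝ] ℝ) :
    (trivializationAt (E →L[ℝ] ℝ) (fun q : Q => TSp E q →L[ℝ] ℝ) q₀
      (Bundle.TotalSpace.mk' (E →L[ℝ] ℝ) (E := fun q : Q => TSp E q →L[ℝ] ℝ) q α)).2 =
      α.comp (chartDerivSymm E q₀ (extChartAt 𝓘(ℝ, E) q₀ q)) := by
  rw [hom_trivializationAt_apply]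
  simp only [ContinuousLinearMap.inCoordinates]
  rw [← trivializationAt_symmL_eq hq]
  ext v
  simp
  rfl

/-- The bundle of bilinear forms is an iterated Hom bundle; its trivialization inserts the inverse
chart derivative once for each argument. -/
theorem trivializationAt_bilin_apply {q₀ q : Q} (hq : q ∈ (extChartAt 𝓘(ℝ, E) q₀).source)
    (α : E →L[ℝ] E →L[ℝ] ℝ) :
    (trivializationAt (E →L[ℝ] E →L[ℝ] ℝ) (fun q : Q => TSp E q →L[ℝ] TSp E q →L[ℝ] ℝ) q₀
      (Bundle.TotalSpace.mk' (E →L[ℝ] E →L[ℝ] ℝ)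
        (E := fun q : Q => TSp E q →L[ℝ] TSp E q →L[ℝ] ℝ) q α)).2 =
      α.bilinearComp (chartDerivSymm E q₀ (extChartAt 𝓘(ℝ, E) q₀ q))
        (chartDerivSymm E q₀ (extChartAt 𝓘(ℝ, E) q₀ q)) := by
  have hq' : q ∈ (chartAt E q₀).source := by simpa using hq
  have h1 : ∀ β : E →L[ℝ] ℝ, ((trivializationAt (E →L[ℝ] ℝ) (fun q : Q => TSp E q →L[ℝ] ℝ)
      q₀).continuousLinearMapAt ℝ q β : E →L[ℝ] ℝ) =
      β.comp (chartDerivSymm E q₀ (extChartAt 𝓘(ℝ, E) q₀ q)) := by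
    intro β
    rw [Bundle.Trivialization.continuousLinearMapAt_apply,
      Bundle.Trivialization.coe_linearMapAt_of_mem _ (by simpa using hq')]
    exact trivializationAt_cotangent_apply hq β
  rw [hom_trivializationAt_apply]
  simp only [ContinuousLinearMap.inCoordinates]
  have h2 := trivializationAt_symmL_eq hq
  ext v w
  refine (DFunLike.congr_fun (h1 (α ((trivializationAt E (TangentSpace 𝓘(ℝ, E)) q₀).symmL
    ℝ q v))) w).trans ?_
  rw [h2]
  rfl

/-- The expression of a metric in the chart at `q₀`. -/
def LorentzMetric.inChart (g : LorentzMetric E Q) (q₀ : Q) (y : E) : E →L[ℝ] E →L[ℝ] ℝ :=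
  ContinuousLinearMap.bilinearComp (E := E) (F := E) (g.val ((extChartAt 𝓘(ℝ, E) q₀).symm y))
    (chartDerivSymm E q₀ y) (chartDerivSymm E q₀ y)

theorem contDiffAt_of_section {F : Type*} [NormedAddCommGroup F] [NormedSpace ℝ F]
    {s : Q → F} {f : E → F} {q₀ : Q} {y : E} (hy : y ∈ (extChartAt 𝓘(ℝ, E) q₀).target)
    (hs : ContMDiffAt 𝓘(ℝ, E) 𝓘(ℝ, F) ∞ s ((extChartAt 𝓘(ℝ, E) q₀).symm y))
    (h : ∀ y ∈ (extChartAt 𝓘(ℝ, E) q₀).target, f y = s ((extChartAt 𝓘(ℝ, E) q₀).symm y)) :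
    ContDiffAt ℝ ∞ f y := by
  have h1 : ContMDiffAt 𝓘(ℝ, E) 𝓘(ℝ, F) ∞ (s ∘ (extChartAt 𝓘(ℝ, E) q₀).symm) y :=
    hs.comp y (contMDiffAt_extChartAt_symm_of_mem hy)
  refine h1.contDiffAt.congr_of_eventuallyEq ?_
  filter_upwards [(isOpen_extChartAt_target (I := 𝓘(ℝ, E)) q₀).mem_nhds hy] with z hz
  exact h z hz

set_option synthInstance.maxHeartbeats 200000 in
theorem LorentzMetric.contDiffAt_inChart (g : LorentzMetric E Q) {q₀ : Q} {y : E}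
    (hy : y ∈ (extChartAt 𝓘(ℝ, E) q₀).target) : ContDiffAt ℝ ∞ (g.inChart q₀) y := by
  have hq := (extChartAt 𝓘(ℝ, E) q₀).map_target hy
  have h := g.smooth ((extChartAt 𝓘(ℝ, E) q₀).symm y)
  rw [Bundle.Trivialization.contMDiffAt_section_iff (trivializationAt (E →L[ℝ] E →L[ℝ] ℝ)
    (fun q : Q => TSp E q →L[ℝ] TSp E q →L[ℝ] ℝ) q₀) (by simpa using hq)] at h
  refine contDiffAt_of_section hy h fun z hz => ?_
  refine Eq.trans ?_ (trivializationAt_bilin_apply ((extChartAt 𝓘(ℝ, E) q₀).map_target hz) _).symm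
  rw [(extChartAt 𝓘(ℝ, E) q₀).right_inv hz]
  rfl

theorem SmoothOneForm.contDiffAt_inChart (A : SmoothOneForm E Q) {q₀ : Q} {y : E}
    (hy : y ∈ (extChartAt 𝓘(ℝ, E) q₀).target) :
    ContDiffAt ℝ ∞ (oneFormInChart 𝓘(ℝ, E) A.val q₀) y := by
  have hq := (extChartAt 𝓘(ℝ, E) q₀).map_target hy
  have h := A.smooth ((extChartAt 𝓘(ℝ, E) q₀).symm y)
  rw [Bundle.Trivialization.contMDiffAt_section_iff (trivializationAt (E →L[ℝ] ℝ)
    (fun q : Q => TSp E q →L[ℝ] ℝ) q₀) (by simpa using hq)] at h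
  refine contDiffAt_of_section hy h fun z hz => ?_
  refine Eq.trans ?_ (trivializationAt_cotangent_apply
    ((extChartAt 𝓘(ℝ, E) q₀).map_target hz) _).symm
  rw [(extChartAt 𝓘(ℝ, E) q₀).right_inv hz]
  rfl

end LocalExpressions

/-! ### The forms `θ_g` and `ω_g` in coordinates, and the pullback of `A` to `TQ`. -/

section LocalForms

variable {E : Type*} [NormedAddCommGroup E] [NormedSpace ℝ E]
  {Q : Type*} [TopologicalSpace Q] [ChartedSpace E Q] [IsManifold 𝓘(ℝ, E) ∞ Q]

theorem dproj_tangentChartDerivSymm {u₀ : TB E Q} {z : E × E}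
    (hz : z.1 ∈ (extChartAt 𝓘(ℝ, E) u₀.proj).target) (h : E × E) :
    (dproj ((extChartAt (𝓘(ℝ, E)).tangent u₀).symm z) (tangentChartDerivSymm u₀ z h) : E) =
      chartDerivSymm E u₀.proj z.1 h.1 := by
  have h1 := (extChartAt 𝓘(ℝ, E) u₀.proj).map_target hz
  have h2 := chartDeriv_dproj (u₀ := u₀) (u := (extChartAt (𝓘(ℝ, E)).tangent u₀).symm z) h1
    (tangentChartDerivSymm u₀ z h)
  rw [tangentChartDeriv_symm (mem_tangentChart_target.2 hz)] at h2
  have h3 := chartDerivSymm_chartDeriv h1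
    (dproj ((extChartAt (𝓘(ℝ, E)).tangent u₀).symm z) (tangentChartDerivSymm u₀ z h))
  rw [(extChartAt 𝓘(ℝ, E) u₀.proj).right_inv hz] at h3
  rw [← h2]
  exact h3.symm

theorem LorentzMetric.inChart_chartDeriv (g : LorentzMetric E Q) {q₀ q : Q}
    (hq : q ∈ (extChartAt 𝓘(ℝ, E) q₀).source) (v w : TSp E q) :
    g.inChart q₀ (extChartAt 𝓘(ℝ, E) q₀ q) (chartDeriv E q₀ q v) (chartDeriv E q₀ q w) =
      g.val q v w := by
  have key : ∀ (p : Q) (v' w' : E), p = q → v' = v → w' = w →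
      (g.val p : E →L[ℝ] E →L[ℝ] ℝ) v' w' = g.val q v w := by
    rintro p v' w' rfl rfl rfl; rfl
  exact key _ _ _ ((extChartAt 𝓘(ℝ, E) q₀).left_inv hq) (chartDerivSymm_chartDeriv hq v)
    (chartDerivSymm_chartDeriv hq w)

theorem oneFormInChart_chartDeriv (θ : ∀ q : Q, TSp E q →L[ℝ] ℝ) {q₀ q : Q}
    (hq : q ∈ (extChartAt 𝓘(ℝ, E) q₀).source) (v : TSp E q) :
    oneFormInChart 𝓘(ℝ, E) θ q₀ (extChartAt 𝓘(ℝ, E) q₀ q) (chartDeriv E q₀ q v) = θ q v := by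
  have key : ∀ (p : Q) (v' : E), p = q → v' = v → (θ p : E →L[ℝ] ℝ) v' = θ q v := by
    rintro p v' rfl rfl; rfl
  exact key _ _ ((extChartAt 𝓘(ℝ, E) q₀).left_inv hq) (chartDerivSymm_chartDeriv hq v)

/-- A function on `TQ` is smooth if its local expression is. -/
theorem contMDiffAt_of_tangentChart {F : Type*} [NormedAddCommGroup F] [NormedSpace ℝ F]
    {f : TB E Q → F} {f' : E × E → F} {u₀ : TB E Q}
    (hf' : ContDiffAt ℝ ∞ f' (extChartAt (𝓘(ℝ, E)).tangent u₀ u₀))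
    (h : ∀ u : TB E Q, u.proj ∈ (extChartAt 𝓘(ℝ, E) u₀.proj).source →
      f u = f' (extChartAt 𝓘(ℝ, E) u₀.proj u.proj, chartDeriv E u₀.proj u.proj u.snd)) :
    ContMDiffAt (𝓘(ℝ, E)).tangent 𝓘(ℝ, F) ∞ f u₀ := by
  have h1 : ContMDiffAt (𝓘(ℝ, E)).tangent 𝓘(ℝ, F) ∞
      (f' ∘ extChartAt (𝓘(ℝ, E)).tangent u₀) u₀ :=
    hf'.contMDiffAt.comp u₀ contMDiffAt_extChartAt
  refine h1.congr_of_eventuallyEq ?_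
  filter_upwards [(isOpen_extChartAt_source (I := (𝓘(ℝ, E)).tangent) u₀).mem_nhds
    (mem_extChartAt_source u₀)] with u hu
  have hu' := mem_tangentChart_source.1 hu
  rw [h u hu', Function.comp_apply, tangentChart_apply hu']

theorem fst_tangentChart_mem (u₀ : TB E Q) :
    (extChartAt (𝓘(ℝ, E)).tangent u₀ u₀).1 ∈ (extChartAt 𝓘(ℝ, E) u₀.proj).target :=
  mem_tangentChart_target.1 (mem_extChartAt_target u₀)

theorem LorentzMetric.contMDiff_normSq (g : LorentzMetric E Q) :
    ContMDiff (𝓘(ℝ, E)).tangent 𝓘(ℝ, ℝ) ∞ g.normSq := by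
  intro u₀
  refine contMDiffAt_of_tangentChart (f' := fun z => g.inChart u₀.proj z.1 z.2 z.2) ?_ ?_
  · have h := (g.contDiffAt_inChart (fst_tangentChart_mem u₀)).comp
      (extChartAt (𝓘(ℝ, E)).tangent u₀ u₀) contDiffAt_fst
    exact (h.clm_apply contDiffAt_snd).clm_apply contDiffAt_snd
  · intro u hu
    exact (g.inChart_chartDeriv hu u.snd u.snd).symm

theorem SmoothOneForm.contMDiff_apply (A : SmoothOneForm E Q) :
    ContMDiff (𝓘(ℝ, E)).tangent 𝓘(ℝ, ℝ) ∞ (fun u : TB E Q => A.val u.proj u.snd) := by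
  intro u₀
  refine contMDiffAt_of_tangentChart
    (f' := fun z => oneFormInChart 𝓘(ℝ, E) A.val u₀.proj z.1 z.2) ?_ ?_
  · have h := (A.contDiffAt_inChart (fst_tangentChart_mem u₀)).comp
      (extChartAt (𝓘(ℝ, E)).tangent u₀ u₀) contDiffAt_fst
    exact h.clm_apply contDiffAt_snd
  · intro u hu
    exact (oneFormInChart_chartDeriv A.val hu u.snd).symm

/-- The expression of `θ_g` in a chart of `TQ`. -/
theorem LorentzMetric.oneFormInChart_oneForm (g : LorentzMetric E Q) {u₀ : TB E Q} {z : E × E}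
    (hz : z.1 ∈ (extChartAt 𝓘(ℝ, E) u₀.proj).target) :
    oneFormInChart (𝓘(ℝ, E)).tangent g.oneForm u₀ z =
      (g.inChart u₀.proj z.1 z.2).comp (ContinuousLinearMap.fst ℝ E E) := by
  have key : ∀ (v w v' w' : E), v = v' → w = w' →
      (g.val ((extChartAt 𝓘(ℝ, E) u₀.proj).symm z.1) : E →L[ℝ] E →L[ℝ] ℝ) v w =
      (g.val ((extChartAt 𝓘(ℝ, E) u₀.proj).symm z.1) : E →L[ℝ] E →L[ℝ] ℝ) v' w' := by
    rintro v w _ _ rfl rfl; rfl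
  refine ContinuousLinearMap.ext fun h => ?_
  exact key _ _ _ _ (tangentChart_symm_snd hz) (dproj_tangentChartDerivSymm hz h)

/-- In coordinates `θ_g` at `(q, v)` is `g_q(v, dq)`; the two terms come from varying `v` and from
varying `q`. -/
theorem LorentzMetric.hasFDerivAt_oneFormInChart (g : LorentzMetric E Q) {u₀ : TB E Q} {z : E × E}
    (hz : z.1 ∈ (extChartAt 𝓘(ℝ, E) u₀.proj).target) :
    DifferentiableAt ℝ (oneFormInChart (𝓘(ℝ, E)).tangent g.oneForm u₀) z ∧
    ∀ h h' : E × E, fderiv ℝ (oneFormInChart (𝓘(ℝ, E)).tangent g.oneForm u₀) z h h' =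
      g.inChart u₀.proj z.1 h.2 h'.1 + fderiv ℝ (g.inChart u₀.proj) z.1 h.1 z.2 h'.1 := by
  have h1 : oneFormInChart (𝓘(ℝ, E)).tangent g.oneForm u₀ =ᶠ[𝓝 z]
      fun z => (g.inChart u₀.proj z.1 z.2).comp (ContinuousLinearMap.fst ℝ E E) := by
    filter_upwards [(isOpen_extChartAt_target (I := (𝓘(ℝ, E)).tangent) u₀).mem_nhds
      (mem_tangentChart_target.2 hz)] with z' hz'
    exact g.oneFormInChart_oneForm (mem_tangentChart_target.1 hz')
  have h2 : HasFDerivAt (fun z : E × E => g.inChart u₀.proj z.1)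
      ((fderiv ℝ (g.inChart u₀.proj) z.1).comp (ContinuousLinearMap.fst ℝ E E)) z :=
    ((g.contDiffAt_inChart hz).differentiableAt (by simp)).hasFDerivAt.comp z hasFDerivAt_fst
  have h3 := ((h2.clm_apply hasFDerivAt_snd).clm_comp
    (hasFDerivAt_const (ContinuousLinearMap.fst ℝ E E) z)).congr_of_eventuallyEq h1
  refine ⟨h3.differentiableAt, fun h h' => ?_⟩
  rw [h3.fderiv]
  simp

theorem LorentzMetric.contDiffAt_oneFormInChart (g : LorentzMetric E Q) {u₀ : TB E Q} {z : E × E}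
    (hz : z.1 ∈ (extChartAt 𝓘(ℝ, E) u₀.proj).target) :
    ContDiffAt ℝ ∞ (oneFormInChart (𝓘(ℝ, E)).tangent g.oneForm u₀) z := by
  have h1 : oneFormInChart (𝓘(ℝ, E)).tangent g.oneForm u₀ =ᶠ[𝓝 z]
      fun z => (g.inChart u₀.proj z.1 z.2).comp (ContinuousLinearMap.fst ℝ E E) := by
    filter_upwards [(isOpen_extChartAt_target (I := (𝓘(ℝ, E)).tangent) u₀).mem_nhds
      (mem_tangentChart_target.2 hz)] with z' hz'
    exact g.oneFormInChart_oneForm (mem_tangentChart_target.1 hz')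
  refine ContDiffAt.congr_of_eventuallyEq ?_ h1
  have h := (g.contDiffAt_inChart hz).comp z contDiffAt_fst
  exact (h.clm_apply contDiffAt_snd).clm_comp contDiffAt_const

/-- The expression of `ω_g` in the chart of `TQ` at `u₀`. -/
def LorentzMetric.twoFormInChart (g : LorentzMetric E Q) (u₀ : TB E Q) (z : E × E) :
    E × E →L[ℝ] E × E →L[ℝ] ℝ :=
  (fderiv ℝ (oneFormInChart (𝓘(ℝ, E)).tangent g.oneForm u₀) z).flip -
    fderiv ℝ (oneFormInChart (𝓘(ℝ, E)).tangent g.oneForm u₀) z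

/-- The exterior derivative is defined with the chart centred at the point. Here `u` moves while the
chart at `u₀` stays fixed, as the smoothness of `S_g` requires. -/
theorem LorentzMetric.twoForm_eq_twoFormInChart (g : LorentzMetric E Q) {u₀ u : TB E Q}
    (hu : u.proj ∈ (extChartAt 𝓘(ℝ, E) u₀.proj).source) (w w' : TTSp u) :
    g.twoForm u w w' = g.twoFormInChart u₀ (extChartAt (𝓘(ℝ, E)).tangent u₀ u)
      (tangentChartDeriv u₀ u w) (tangentChartDeriv u₀ u w') := by
  have hu' := mem_tangentChart_source.2 hu
  have hz := mem_tangentChart_target.1 ((extChartAt (𝓘(ℝ, E)).tangent u₀).map_source hu')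
  have h := extDerivOneForm_eq_of_mem_source g.oneForm hu'
    (g.hasFDerivAt_oneFormInChart hz).1 (κ := tangentChartDeriv u₀ u) rfl w w'
  refine (congrArg Neg.neg h).trans ?_
  exact neg_sub _ _

theorem LorentzMetric.twoFormInChart_apply (g : LorentzMetric E Q) {u₀ : TB E Q} {z : E × E}
    (hz : z.1 ∈ (extChartAt 𝓘(ℝ, E) u₀.proj).target) (h h' : E × E) :
    g.twoFormInChart u₀ z h h' =
      (g.inChart u₀.proj z.1 h'.2 h.1 + fderiv ℝ (g.inChart u₀.proj) z.1 h'.1 z.2 h.1) -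
      (g.inChart u₀.proj z.1 h.2 h'.1 + fderiv ℝ (g.inChart u₀.proj) z.1 h.1 z.2 h'.1) := by
  rw [← (g.hasFDerivAt_oneFormInChart hz).2, ← (g.hasFDerivAt_oneFormInChart hz).2]
  rfl

/-- A vertical vector has zero base component, which removes every term containing a derivative of
the metric except those cancelled by linearity; only the pairing of fibre with base components
survives. -/
theorem LorentzMetric.twoForm_vertLift (g : LorentzMetric E Q) (u : TB E Q) (ξ : TSp E u.proj)
    (w : TTSp u) : g.twoForm u (vertLift u ξ) w = - g.val u.proj ξ (dproj u w) := by
  have hu := mem_extChartAt_source (I := 𝓘(ℝ, E)) u.proj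
  have h1 := g.twoForm_eq_twoFormInChart hu (vertLift u ξ) w
  have h3 := g.inChart_chartDeriv hu ξ (dproj u w)
  rw [h1, tangentChartDeriv_vertLift hu, ← h3, chartDeriv_dproj hu,
    g.twoFormInChart_apply (fst_tangentChart_mem u)]
  have h4 : (extChartAt (𝓘(ℝ, E)).tangent u u).1 = extChartAt 𝓘(ℝ, E) u.proj u.proj := rfl
  simp only [map_zero, zero_apply, add_zero, zero_sub, h4]

theorem LorentzMetric.twoForm_neg_swap (g : LorentzMetric E Q) (u : TB E Q) (w w' : TTSp u) :
    g.twoForm u w w' = - g.twoForm u w' w :=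
  congrArg Neg.neg (extDerivOneForm_neg_swap g.oneForm u w w')

theorem LorentzMetric.oneForm_differentiableAt (g : LorentzMetric E Q) (u : TB E Q) :
    OneFormDifferentiableAt (𝓘(ℝ, E)).tangent g.oneForm u :=
  (g.hasFDerivAt_oneFormInChart (fst_tangentChart_mem u)).1

theorem SmoothOneForm.pullback_differentiableAt (A : SmoothOneForm E Q) (u : TB E Q) :
    OneFormDifferentiableAt (𝓘(ℝ, E)).tangent
      (oneFormPullback (𝓘(ℝ, E)).tangent 𝓘(ℝ, E) (Bundle.TotalSpace.proj : TB E Q → Q) A.val) u :=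
  OneFormDifferentiableAt.pullback contMDiff_tangentProj.contMDiffAt
    ((A.contDiffAt_inChart (mem_extChartAt_target u.proj)).differentiableAt (by simp))

theorem SmoothOneForm.extDeriv_pullback (A : SmoothOneForm E Q) (u : TB E Q) (w w' : TTSp u) :
    extDerivOneForm (𝓘(ℝ, E)).tangent
      (oneFormPullback (𝓘(ℝ, E)).tangent 𝓘(ℝ, E) (Bundle.TotalSpace.proj : TB E Q → Q) A.val) u
      w w' = extDerivOneForm 𝓘(ℝ, E) A.val u.proj (dproj u w) (dproj u w') :=
  extDerivOneForm_pullback contMDiff_tangentProj.contMDiffAt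
    ((A.contDiffAt_inChart (mem_extChartAt_target u.proj)).differentiableAt (by simp)) w w'

end LocalForms

/-! ### Rules for differentials of functions and constant multiples of forms. -/

section Differential

variable {E : Type*} [NormedAddCommGroup E] [NormedSpace ℝ E] {H : Type*} [TopologicalSpace H]
  {I : ModelWithCorners ℝ E H} {N : Type*} [TopologicalSpace N] [ChartedSpace H N]

theorem differential_congr {f h : N → ℝ} {x : N} (hfh : f =ᶠ[𝓝 x] h) :
    differential I f x = differential I h x :=
  hfh.mfderiv_eq

theorem differential_comp {f : N → ℝ} {x : N} {F : ℝ → ℝ} {F' : ℝ}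
    (hf : MDifferentiableAt I 𝓘(ℝ, ℝ) f x) (hF : HasDerivAt F F' (f x)) (w : TangentSpace I x) :
    differential I (fun z => F (f z)) x w = F' * differential I f x w := by
  have h := hF.hasFDerivAt.hasMFDerivAt.comp x hf.hasMFDerivAt
  refine (DFunLike.congr_fun h.mfderiv w).trans ?_
  exact mul_comm (differential I f x w) F'

theorem differential_const_mul {f : N → ℝ} {x : N}
    (hf : MDifferentiableAt I 𝓘(ℝ, ℝ) f x) (r : ℝ) (w : TangentSpace I x) :
    differential I (fun z => r * f z) x w = r * differential I f x w :=
  differential_comp hf ((hasDerivAt_id (f x)).const_mul r |>.congr_deriv (mul_one r)) w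

theorem differential_sub_const {f : N → ℝ} {x : N}
    (hf : MDifferentiableAt I 𝓘(ℝ, ℝ) f x) (r : ℝ) (w : TangentSpace I x) :
    differential I (fun z => f z - r) x w = differential I f x w :=
  (differential_comp hf ((hasDerivAt_id (f x)).sub_const r) w).trans (one_mul _)

theorem differential_add {f h : N → ℝ} {x : N}
    (hf : MDifferentiableAt I 𝓘(ℝ, ℝ) f x) (hh : MDifferentiableAt I 𝓘(ℝ, ℝ) h x)
    (w : TangentSpace I x) :
    differential I (fun z => f z + h z) x w = differential I f x w + differential I h x w :=
  DFunLike.congr_fun (hf.hasMFDerivAt.add hh.hasMFDerivAt).mfderiv w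

theorem OneFormDifferentiableAt.const_smul [I.Boundaryless] [IsManifold I ∞ N]
    {θ : ∀ x : N, TangentSpace I x →L[ℝ] ℝ} {x : N}
    (h : OneFormDifferentiableAt I θ x) (r : ℝ) :
    OneFormDifferentiableAt I (fun z => r • θ z) x :=
  OneFormDifferentiableAt.smul (f := fun _ => r) mdifferentiableAt_const h

theorem extDerivOneForm_const_smul [I.Boundaryless] [IsManifold I ∞ N]
    {θ : ∀ x : N, TangentSpace I x →L[ℝ] ℝ} {x : N} (h : OneFormDifferentiableAt I θ x) (r : ℝ)
    (w w' : TangentSpace I x) :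
    extDerivOneForm I (fun z => r • θ z) x w w' = r * extDerivOneForm I θ x w w' := by
  have h1 : ∀ w, differential I (fun _ : N => r) x w = 0 := fun w =>
    DFunLike.congr_fun (mfderiv_const (I := I) (I' := 𝓘(ℝ, ℝ)) (c := r) (x := x)) w
  rw [extDerivOneForm_smul (f := fun _ => r) mdifferentiableAt_const h, h1, h1]
  ring

end Differential

/-! ### Nondegenerate bilinear forms in finite dimension. -/

section LinearAlgebra

variable {V : Type*} [NormedAddCommGroup V] [NormedSpace ℝ V] [FiniteDimensional ℝ V]

theorem exists_equiv_of_injective {B : V →L[ℝ] V →L[ℝ] ℝ} (h : Function.Injective B) :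
    ∃ e : V ≃L[ℝ] V →L[ℝ] ℝ, (e : V →L[ℝ] V →L[ℝ] ℝ) = B := by
  have hdim : Module.finrank ℝ V = Module.finrank ℝ (V →L[ℝ] ℝ) := by
    rw [← (LinearMap.toContinuousLinearMap (𝕜 := ℝ) (E := V) (F' := ℝ)).finrank_eq]
    exact (Subspace.dual_finrank_eq (K := ℝ) (V := V)).symm
  exact ⟨(LinearEquiv.ofInjectiveOfFinrankEq B.toLinearMap h hdim).toContinuousLinearEquiv, rfl⟩

theorem bijective_of_bilin_injective {B : V →L[ℝ] V →L[ℝ] ℝ} (h : Function.Injective B) :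
    Function.Bijective B := by
  obtain ⟨e, rfl⟩ := exists_equiv_of_injective h
  exact e.bijective

theorem apply_inverse_of_bilin_injective {B : V →L[ℝ] V →L[ℝ] ℝ} (h : Function.Injective B)
    (α : V →L[ℝ] ℝ) : B (B.inverse α) = α := by
  obtain ⟨e, rfl⟩ := exists_equiv_of_injective h
  rw [ContinuousLinearMap.inverse_equiv]
  exact e.apply_symm_apply α

end LinearAlgebra

/-! ### Nondegeneracy of `ω_g` and the geodesic field. -/

namespace LorentzMetric

variable {E : Type*} [NormedAddCommGroup E] [NormedSpace ℝ E]
  {Q : Type*} [TopologicalSpace Q] [ChartedSpace E Q] [IsManifold 𝓘(ℝ, E) ∞ Q]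
  (g : LorentzMetric E Q)

/-- By `flat_sharp` every covector is `g(η, ·)` for some `η`, so every covector vanishes on `ξ`. -/
theorem eq_zero_of_forall {q : Q} {ξ : TSp E q} (h : ∀ η, g.val q ξ η = 0) : ξ = 0 := by
  have key : ∀ α : E →L[ℝ] ℝ, α ξ = 0 := by
    intro α
    have h1 := DFunLike.congr_fun (g.flat_sharp q α) ξ
    rw [g.symm, h] at h1
    exact h1.symm
  exact SeparatingDual.eq_zero_of_forall_dual_eq_zero (R := ℝ) (V := E) key

theorem ext_of_forall {q : Q} {ξ ξ' : TSp E q} (h : ∀ η, g.val q ξ η = g.val q ξ' η) :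
    ξ = ξ' := by
  refine sub_eq_zero.1 (g.eq_zero_of_forall fun η => ?_)
  rw [map_sub, sub_apply, h, sub_self]

theorem mdifferentiableAt_normSq (u : TB E Q) :
    MDifferentiableAt (𝓘(ℝ, E)).tangent 𝓘(ℝ, ℝ) g.normSq u :=
  g.contMDiff_normSq.mdifferentiableAt (by simp)

theorem hasFDerivAt_normSq_fibre (q : Q) (v : E) :
    HasFDerivAt (fun η : E => g.normSq (fibreInclusion q η))
      ((2 : ℝ) • (g.val q v : E →L[ℝ] ℝ)) v := by
  obtain ⟨B, hB⟩ : ∃ B : E →L[ℝ] E →L[ℝ] ℝ, B = g.val q := ⟨_, rfl⟩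
  have hs : ∀ x y : E, B x y = B y x := by rw [hB]; exact g.symm q
  have h1 : HasFDerivAt (fun η : E => B η η) ((2 : ℝ) • B v) v := by
    refine (B.hasFDerivAt.clm_apply (hasFDerivAt_id v)).congr_fderiv ?_
    ext x
    simp [hs x v, two_mul]
  rw [hB] at h1
  exact h1

theorem differential_normSq_vertLift (u : TB E Q) (ξ : TSp E u.proj) :
    differential (𝓘(ℝ, E)).tangent g.normSq u (vertLift u ξ) = 2 * g.val u.proj u.snd ξ :=
  differential_vertLift (g.mdifferentiableAt_normSq u) (g.hasFDerivAt_normSq_fibre u.proj u.snd) ξ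

theorem differential_energy (u : TB E Q) (w : TTSp u) :
    differential (𝓘(ℝ, E)).tangent g.energy u w =
      1 / 2 * differential (𝓘(ℝ, E)).tangent g.normSq u w :=
  differential_const_mul (g.mdifferentiableAt_normSq u) (1 / 2) w

theorem differential_constraint (c : ℝ) (u : TB E Q) (w : TTSp u) :
    differential (𝓘(ℝ, E)).tangent (g.constraint c) u w =
      2 * differential (𝓘(ℝ, E)).tangent g.energy u w := by
  rw [g.differential_energy]
  refine (differential_sub_const (g.mdifferentiableAt_normSq u) (c ^ 2) w).trans ?_
  ring

theorem differential_energy_vertLift (u : TB E Q) (ξ : TSp E u.proj) :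
    differential (𝓘(ℝ, E)).tangent g.energy u (vertLift u ξ) = g.val u.proj u.snd ξ := by
  rw [g.differential_energy, g.differential_normSq_vertLift]
  ring

/-- A skew form on `T_u(TQ)` whose contraction with vertical vectors is a nonzero multiple of that
of `ω_g` is nondegenerate. -/
theorem injective_of_vertLift {u : TB E Q} {B : TTSp u →L[ℝ] TTSp u →L[ℝ] ℝ} {k : ℝ} (hk : k ≠ 0)
    (hB : ∀ w w', B w w' = - B w' w)
    (hv : ∀ ξ w, B (vertLift u ξ) w = k * g.val u.proj ξ (dproj u w)) :
    Function.Injective B := by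
  refine (injective_iff_map_eq_zero B).2 fun w hw => ?_
  -- A vector in the kernel is paired with vertical vectors to show that it is vertical, and then,
  -- through its own vertical form, with arbitrary vectors to show that it is zero.
  have h1 : dproj u w = 0 := by
    refine g.eq_zero_of_forall fun ξ => ?_
    have h2 := hv ξ w
    rw [hB, hw, g.symm] at h2
    have h3 : k * g.val u.proj (dproj u w) ξ = 0 := by simpa using h2.symm
    exact (mul_eq_zero.1 h3).resolve_left hk
  obtain ⟨η, rfl⟩ := exists_eq_vertLift h1
  have h2 : η = 0 := by
    refine g.eq_zero_of_forall fun ξ => ?_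
    obtain ⟨w', rfl⟩ := dproj_surjective u ξ
    have h3 := hv η w'
    rw [hw] at h3
    have h4 : k * g.val u.proj η (dproj u w') = 0 := by simpa using h3.symm
    exact (mul_eq_zero.1 h4).resolve_left hk
  rw [h2, map_zero]

theorem twoForm_injective (u : TB E Q) : Function.Injective (g.twoForm u) :=
  g.injective_of_vertLift (k := -1) (by norm_num) (g.twoForm_neg_swap u)
    fun ξ w => by rw [g.twoForm_vertLift]; ring

theorem twoForm_bijective [FiniteDimensional ℝ E] (u : TB E Q) :
    Function.Bijective (g.twoForm u) :=
  bijective_of_bilin_injective (V := E × E) (g.twoForm_injective u)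

theorem twoForm_geodesicField [FiniteDimensional ℝ E] (u : TB E Q) :
    g.twoForm u (g.geodesicField u) = differential (𝓘(ℝ, E)).tangent g.energy u :=
  apply_inverse_of_bilin_injective (V := E × E) (g.twoForm_injective u) _

/-- Contracting `i_{S_g} ω_g = dE_g` with `ξ^∨` gives `g(ξ, Tτ S_g) = g(u, ξ)`: the geodesic field
is second-order. -/
theorem dproj_geodesicField [FiniteDimensional ℝ E] (u : TB E Q) :
    dproj u (g.geodesicField u) = u.snd := by
  refine g.ext_of_forall fun ξ => ?_
  rw [← g.differential_energy_vertLift, ← g.twoForm_geodesicField, g.twoForm_neg_swap,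
    g.twoForm_vertLift, neg_neg, g.symm]

theorem differential_energy_geodesicField [FiniteDimensional ℝ E] (u : TB E Q) :
    differential (𝓘(ℝ, E)).tangent g.energy u (g.geodesicField u) = 0 := by
  have h := g.twoForm_neg_swap u (g.geodesicField u) (g.geodesicField u)
  rw [g.twoForm_geodesicField] at h
  linarith

end LorentzMetric

/-! ### Lagrange forms and energies of `L₁` and `L₂`. -/

namespace LorentzMetric

variable {E : Type*} [NormedAddCommGroup E] [NormedSpace ℝ E]
  {Q : Type*} [TopologicalSpace Q] [ChartedSpace E Q] [IsManifold 𝓘(ℝ, E) ∞ Q]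
  (g : LorentzMetric E Q) (A : SmoothOneForm E Q) {U : Q → ℝ} (m e c : ℝ)

theorem contMDiff_potential (hU : ContMDiff 𝓘(ℝ, E) 𝓘(ℝ, ℝ) ∞ U) :
    ContMDiff (𝓘(ℝ, E)).tangent 𝓘(ℝ, ℝ) ∞ (fun u : TB E Q => U u.proj) :=
  hU.comp contMDiff_tangentProj

theorem differential_potential (hU : ContMDiff 𝓘(ℝ, E) 𝓘(ℝ, ℝ) ∞ U) (u : TB E Q) (w : TTSp u) :
    differential (𝓘(ℝ, E)).tangent (fun u : TB E Q => U u.proj) u w =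
      differential 𝓘(ℝ, E) U u.proj (dproj u w) :=
  DFunLike.congr_fun ((hU.mdifferentiableAt (by simp)).hasMFDerivAt.comp u
    (contMDiff_tangentProj.mdifferentiableAt (by simp)).hasMFDerivAt).mfderiv w

theorem hasFDerivAt_apply_fibre (q : Q) (v : E) :
    HasFDerivAt (fun η : E => A.val (fibreInclusion q η).proj (fibreInclusion q η).snd)
      (A.val q : E →L[ℝ] ℝ) v := by
  obtain ⟨a, ha⟩ : ∃ a : E →L[ℝ] ℝ, a = A.val q := ⟨_, rfl⟩
  have h : HasFDerivAt (fun η : E => a η) a v := a.hasFDerivAt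
  rw [ha] at h
  exact h

theorem mdifferentiableAt_lagrangian₂ (hU : ContMDiff 𝓘(ℝ, E) 𝓘(ℝ, ℝ) ∞ U) (u : TB E Q) :
    MDifferentiableAt (𝓘(ℝ, E)).tangent 𝓘(ℝ, ℝ) (g.lagrangian₂ A U m e c) u := by
  have h1 := g.contMDiff_normSq
  have h2 := A.contMDiff_apply
  have h3 := contMDiff_potential hU
  have h : ContMDiff (𝓘(ℝ, E)).tangent 𝓘(ℝ, ℝ) ∞ (g.lagrangian₂ A U m e c) :=
    (((contMDiff_const.mul h1).neg).sub (contMDiff_const.mul h2)).sub h3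
  exact h.mdifferentiableAt (by simp)

theorem mdifferentiableAt_lagrangian₁ (hU : ContMDiff 𝓘(ℝ, E) 𝓘(ℝ, ℝ) ∞ U)
    {u : TB E Q} (hu : 0 < g.normSq u) :
    MDifferentiableAt (𝓘(ℝ, E)).tangent 𝓘(ℝ, ℝ) (g.lagrangian₁ A U m e c) u := by
  have h1 : ContMDiffAt (𝓘(ℝ, E)).tangent 𝓘(ℝ, ℝ) ∞ (fun u => Real.sqrt (g.normSq u)) u :=
    (Real.contDiffAt_sqrt hu.ne').contMDiffAt.comp u (g.contMDiff_normSq u)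
  have h2 := A.contMDiff_apply u
  have h3 := contMDiff_potential hU u
  have h : ContMDiffAt (𝓘(ℝ, E)).tangent 𝓘(ℝ, ℝ) ∞ (g.lagrangian₁ A U m e c) u :=
    (((contMDiffAt_const.mul h1).neg).sub (contMDiffAt_const.mul h2)).sub h3
  exact h.mdifferentiableAt (by simp)

theorem differential_lagrangian₂_vertLift (hU : ContMDiff 𝓘(ℝ, E) 𝓘(ℝ, ℝ) ∞ U)
    (u : TB E Q) (ξ : TSp E u.proj) :
    differential (𝓘(ℝ, E)).tangent (g.lagrangian₂ A U m e c) u (vertLift u ξ) =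
      -m * g.val u.proj u.snd ξ - e / c * A.val u.proj ξ := by
  have h1 := g.hasFDerivAt_normSq_fibre u.proj u.snd
  have h2 := hasFDerivAt_apply_fibre A u.proj u.snd
  have h3 := ((h1.const_mul (1 / 2 * m)).neg.sub (h2.const_mul (e / c))).sub_const (U u.proj)
  refine (differential_vertLift (g.mdifferentiableAt_lagrangian₂ A m e c hU u) h3 ξ).trans ?_
  change -(1 / 2 * m * (2 * g.val u.proj u.snd ξ)) - e / c * A.val u.proj ξ = _
  ring

theorem differential_lagrangian₁_vertLift (hU : ContMDiff 𝓘(ℝ, E) 𝓘(ℝ, ℝ) ∞ U)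
    {u : TB E Q} (hu : 0 < g.normSq u) (ξ : TSp E u.proj) :
    differential (𝓘(ℝ, E)).tangent (g.lagrangian₁ A U m e c) u (vertLift u ξ) =
      -(m * c) * (Real.sqrt (g.normSq u))⁻¹ * g.val u.proj u.snd ξ - e / c * A.val u.proj ξ := by
  have h1 := (g.hasFDerivAt_normSq_fibre u.proj u.snd).sqrt hu.ne'
  have h2 := hasFDerivAt_apply_fibre A u.proj u.snd
  have h3 := ((h1.const_mul (m * c)).neg.sub (h2.const_mul (e / c))).sub_const (U u.proj)
  refine (differential_vertLift (g.mdifferentiableAt_lagrangian₁ A m e c hU hu) h3 ξ).trans ?_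
  change -(m * c * (1 / (2 * Real.sqrt (g.normSq u)) * (2 * g.val u.proj u.snd ξ))) -
    e / c * A.val u.proj ξ = _
  have h4 : Real.sqrt (g.normSq u) ≠ 0 := (Real.sqrt_pos.2 hu).ne'
  field_simp

/-- The pullback of a 1-form on `Q` to `TQ`. -/
def pulledBackForm (A : SmoothOneForm E Q) (u : TB E Q) : TTSp u →L[ℝ] ℝ :=
  oneFormPullback (𝓘(ℝ, E)).tangent 𝓘(ℝ, E) (Bundle.TotalSpace.proj : TB E Q → Q) A.val u

theorem lagrangeOneForm_lagrangian₂ (hU : ContMDiff 𝓘(ℝ, E) 𝓘(ℝ, ℝ) ∞ U) (u : TB E Q) :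
    lagrangeOneForm (g.lagrangian₂ A U m e c) u =
      (-m) • g.oneForm u + (-(e / c)) • pulledBackForm A u := by
  ext w
  refine (g.differential_lagrangian₂_vertLift A m e c hU u (dproj u w)).trans ?_
  change _ = -m * g.val u.proj u.snd (dproj u w) + -(e / c) * A.val u.proj (dproj u w)
  ring

theorem lagrangeOneForm_lagrangian₁ (hU : ContMDiff 𝓘(ℝ, E) 𝓘(ℝ, ℝ) ∞ U)
    {u : TB E Q} (hu : 0 < g.normSq u) :
    lagrangeOneForm (g.lagrangian₁ A U m e c) u =
      (-(m * c) * (Real.sqrt (g.normSq u))⁻¹) • g.oneForm u +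
        (-(e / c)) • pulledBackForm A u := by
  ext w
  refine (g.differential_lagrangian₁_vertLift A m e c hU hu (dproj u w)).trans ?_
  change _ = -(m * c) * (Real.sqrt (g.normSq u))⁻¹ * g.val u.proj u.snd (dproj u w) +
    -(e / c) * A.val u.proj (dproj u w)
  ring

theorem lagrangeTwoForm_lagrangian₂ (hU : ContMDiff 𝓘(ℝ, E) 𝓘(ℝ, ℝ) ∞ U) (u : TB E Q) (w w' : TTSp u) :
    lagrangeTwoForm (g.lagrangian₂ A U m e c) u w w' =
      -m * g.twoForm u w w' +
        e / c * extDerivOneForm 𝓘(ℝ, E) A.val u.proj (dproj u w) (dproj u w') := by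
  have h1 : extDerivOneForm (𝓘(ℝ, E)).tangent (lagrangeOneForm (g.lagrangian₂ A U m e c)) u =
      extDerivOneForm (𝓘(ℝ, E)).tangent
        (fun u => (-m) • g.oneForm u + (-(e / c)) • pulledBackForm A u) u :=
    extDerivOneForm_congr (Eventually.of_forall (g.lagrangeOneForm_lagrangian₂ A m e c hU))
  have h2 := g.oneForm_differentiableAt u
  have h3 := A.pullback_differentiableAt u
  have h4 := extDerivOneForm_add (h2.const_smul (-m)) (h3.const_smul (-(e / c))) w w'
  rw [extDerivOneForm_const_smul h2, extDerivOneForm_const_smul h3, A.extDeriv_pullback] at h4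
  have h5 : g.twoForm u w w' = -extDerivOneForm (𝓘(ℝ, E)).tangent g.oneForm u w w' := rfl
  change -(extDerivOneForm (𝓘(ℝ, E)).tangent (lagrangeOneForm (g.lagrangian₂ A U m e c)) u w w') = _
  rw [h1, h5]
  refine (congrArg Neg.neg h4).trans ?_
  ring

theorem eventually_normSq_pos {u : TB E Q} (hu : 0 < g.normSq u) :
    ∀ᶠ z in 𝓝 u, 0 < g.normSq z :=
  (g.contMDiff_normSq.continuous.tendsto u).eventually (lt_mem_nhds hu)

/-- The coefficient `-mc/v` of `θ_g` is not constant, and the Leibniz rule produces the extra term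
in `dE_g ∧ θ_g`. -/
theorem lagrangeTwoForm_lagrangian₁ (hU : ContMDiff 𝓘(ℝ, E) 𝓘(ℝ, ℝ) ∞ U)
    {u : TB E Q} (hu : 0 < g.normSq u) (w w' : TTSp u) :
    lagrangeTwoForm (g.lagrangian₁ A U m e c) u w w' =
      -(m * c) * (Real.sqrt (g.normSq u))⁻¹ * g.twoForm u w w' -
      m * c * (Real.sqrt (g.normSq u))⁻¹ ^ 3 *
        (differential (𝓘(ℝ, E)).tangent g.energy u w * g.oneForm u w' -
          differential (𝓘(ℝ, E)).tangent g.energy u w' * g.oneForm u w) +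
        e / c * extDerivOneForm 𝓘(ℝ, E) A.val u.proj (dproj u w) (dproj u w') := by
  have h1 : extDerivOneForm (𝓘(ℝ, E)).tangent (lagrangeOneForm (g.lagrangian₁ A U m e c)) u =
      extDerivOneForm (𝓘(ℝ, E)).tangent
        (fun u => (-(m * c) * (Real.sqrt (g.normSq u))⁻¹) • g.oneForm u +
          (-(e / c)) • pulledBackForm A u) u := by
    refine extDerivOneForm_congr ?_
    filter_upwards [g.eventually_normSq_pos hu] with z hz
    exact g.lagrangeOneForm_lagrangian₁ A m e c hU hz
  have h2 := g.oneForm_differentiableAt u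
  have h3 := A.pullback_differentiableAt u
  have hs : Real.sqrt (g.normSq u) ≠ 0 := (Real.sqrt_pos.2 hu).ne'
  -- Since `g(u,u) = 2 E_g`, this derivative yields `d(-mc/v) = (mc/v³) dE_g`.
  have h0 : HasDerivAt (fun t => -(m * c) * (Real.sqrt t)⁻¹)
      (-(m * c) * (-(1 / (2 * Real.sqrt (g.normSq u))) / Real.sqrt (g.normSq u) ^ 2))
      (g.normSq u) := ((Real.hasDerivAt_sqrt hu.ne').inv hs).const_mul _
  have hd := g.mdifferentiableAt_normSq u
  have hf : MDifferentiableAt (𝓘(ℝ, E)).tangent 𝓘(ℝ, ℝ)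
      (fun u => -(m * c) * (Real.sqrt (g.normSq u))⁻¹) u :=
    (h0.differentiableAt.mdifferentiableAt).comp u hd
  have h4 := extDerivOneForm_add (OneFormDifferentiableAt.smul hf h2) (h3.const_smul (-(e / c))) w w'
  rw [extDerivOneForm_smul hf h2, extDerivOneForm_const_smul h3, A.extDeriv_pullback,
    differential_comp hd h0, differential_comp hd h0] at h4
  have h5 : g.twoForm u w w' = -extDerivOneForm (𝓘(ℝ, E)).tangent g.oneForm u w w' := rfl
  change -(extDerivOneForm (𝓘(ℝ, E)).tangent (lagrangeOneForm (g.lagrangian₁ A U m e c)) u w w') = _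
  rw [h1, h5, g.differential_energy, g.differential_energy]
  refine (congrArg Neg.neg h4).trans ?_
  field_simp
  ring

/-- By Euler's identity `Δ · L - L` keeps the quadratic term, cancels the linear term and changes
the sign of `-U`. -/
theorem lagrangeEnergy_lagrangian₂ (hU : ContMDiff 𝓘(ℝ, E) 𝓘(ℝ, ℝ) ∞ U) (u : TB E Q) :
    lagrangeEnergy (g.lagrangian₂ A U m e c) u = -m * g.energy u + U u.proj := by
  have h := g.differential_lagrangian₂_vertLift A m e c hU u u.snd
  change differential (𝓘(ℝ, E)).tangent (g.lagrangian₂ A U m e c) u (vertLift u u.snd) -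
    (-(1 / 2 * m * g.val u.proj u.snd u.snd) - e / c * A.val u.proj u.snd - U u.proj) =
    -m * (1 / 2 * g.val u.proj u.snd u.snd) + U u.proj
  rw [h]
  ring

/-- The root and the linear term both have degree one in the velocity, so they contribute nothing to
`Δ · L - L`. -/
theorem lagrangeEnergy_lagrangian₁ (hU : ContMDiff 𝓘(ℝ, E) 𝓘(ℝ, ℝ) ∞ U)
    {u : TB E Q} (hu : 0 < g.normSq u) :
    lagrangeEnergy (g.lagrangian₁ A U m e c) u = U u.proj := by
  have h := g.differential_lagrangian₁_vertLift A m e c hU hu u.snd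
  have hs : Real.sqrt (g.normSq u) ≠ 0 := (Real.sqrt_pos.2 hu).ne'
  have h1 : g.val u.proj u.snd u.snd = Real.sqrt (g.normSq u) ^ 2 := (Real.sq_sqrt hu.le).symm
  change differential (𝓘(ℝ, E)).tangent (g.lagrangian₁ A U m e c) u (vertLift u u.snd) -
    (-(m * c * Real.sqrt (g.normSq u)) - e / c * A.val u.proj u.snd - U u.proj) = U u.proj
  rw [h, h1]
  field_simp
  ring

theorem differential_lagrangeEnergy₂ (hU : ContMDiff 𝓘(ℝ, E) 𝓘(ℝ, ℝ) ∞ U) (u : TB E Q) (w : TTSp u) :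
    differential (𝓘(ℝ, E)).tangent (lagrangeEnergy (g.lagrangian₂ A U m e c)) u w =
      -m * differential (𝓘(ℝ, E)).tangent g.energy u w +
        differential 𝓘(ℝ, E) U u.proj (dproj u w) := by
  have h1 : lagrangeEnergy (g.lagrangian₂ A U m e c) = fun u => -m * g.energy u + U u.proj :=
    funext (g.lagrangeEnergy_lagrangian₂ A m e c hU)
  have hE : MDifferentiableAt (𝓘(ℝ, E)).tangent 𝓘(ℝ, ℝ) g.energy u :=
    (contMDiff_const.mul g.contMDiff_normSq).mdifferentiableAt (n := ∞) (by simp)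
  have hE' : MDifferentiableAt (𝓘(ℝ, E)).tangent 𝓘(ℝ, ℝ) (fun u => -m * g.energy u) u :=
    (contMDiff_const.mul (contMDiff_const.mul g.contMDiff_normSq)).mdifferentiableAt (n := ∞)
      (by simp)
  rw [h1, differential_add hE' ((contMDiff_potential hU).mdifferentiableAt (by simp)),
    differential_const_mul hE, differential_potential hU]

theorem differential_lagrangeEnergy₁ (hU : ContMDiff 𝓘(ℝ, E) 𝓘(ℝ, ℝ) ∞ U)
    {u : TB E Q} (hu : 0 < g.normSq u) (w : TTSp u) :
    differential (𝓘(ℝ, E)).tangent (lagrangeEnergy (g.lagrangian₁ A U m e c)) u w =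
      differential 𝓘(ℝ, E) U u.proj (dproj u w) := by
  rw [← differential_potential hU]
  refine DFunLike.congr_fun (differential_congr ?_) w
  filter_upwards [g.eventually_normSq_pos hu] with z hz
  exact g.lagrangeEnergy_lagrangian₁ A m e c hU hz

end LorentzMetric

/-! ### The constrained equations at a point of `M`. -/

namespace LorentzMetric

variable {E : Type*} [NormedAddCommGroup E] [NormedSpace ℝ E]
  {Q : Type*} [TopologicalSpace Q] [ChartedSpace E Q] [IsManifold 𝓘(ℝ, E) ∞ Q]
  (g : LorentzMetric E Q) (A : SmoothOneForm E Q) {U : Q → ℝ} {m e c : ℝ}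

theorem oneForm_apply (u : TB E Q) (w : TTSp u) :
    g.oneForm u w = g.val u.proj u.snd (dproj u w) := rfl

theorem mem_constraintSet_iff {u : TB E Q} :
    u ∈ constraintSet (g.constraint c) ↔ g.val u.proj u.snd u.snd = c ^ 2 :=
  sub_eq_zero

variable {g}

theorem normSq_pos_of_mem (hc : 0 < c) {u : TB E Q} (hu : u ∈ constraintSet (g.constraint c)) :
    0 < g.normSq u := by
  have h : g.normSq u = c ^ 2 := g.mem_constraintSet_iff.1 hu
  rw [h]
  positivity

theorem sqrt_normSq_of_mem (hc : 0 < c) {u : TB E Q} (hu : u ∈ constraintSet (g.constraint c)) :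
    Real.sqrt (g.normSq u) = c := by
  have h : g.normSq u = c ^ 2 := g.mem_constraintSet_iff.1 hu
  rw [h, Real.sqrt_sq hc.le]

theorem speed_of_mem (hc : 0 < c) {u : TB E Q} (hu : u ∈ constraintSet (g.constraint c)) :
    g.speed u = c := by
  have h : 2 * g.energy u = g.normSq u := by
    rw [LorentzMetric.energy]; ring
  rw [speed, h, sqrt_normSq_of_mem hc hu]

variable (g)

theorem mem_constraintTangent_iff {u : TB E Q} {w : TTSp u} :
    w ∈ constraintTangent (g.constraint c) u ↔
      differential (𝓘(ℝ, E)).tangent g.energy u w = 0 := by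
  have h := g.differential_constraint c u w
  constructor
  · intro hw
    have h1 : differential (𝓘(ℝ, E)).tangent (g.constraint c) u w = 0 := hw
    linarith
  · intro hw
    have h1 : differential (𝓘(ℝ, E)).tangent (g.constraint c) u w = 0 := by rw [h, hw, mul_zero]
    exact h1

theorem differential_constraint_vertLift (c : ℝ) (u : TB E Q) (ξ : TSp E u.proj) :
    differential (𝓘(ℝ, E)).tangent (g.constraint c) u (vertLift u ξ) =
      2 * g.val u.proj u.snd ξ := by
  rw [g.differential_constraint, g.differential_energy_vertLift]

theorem mem_constraintForces_iff (hc : 0 < c) {u : TB E Q}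
    (hu : u ∈ constraintSet (g.constraint c)) {β : TTSp u →L[ℝ] ℝ} :
    β ∈ constraintForces (g.constraint c) u ↔ ∃ l : ℝ, ∀ w, β w = l * g.oneForm u w := by
  have hu' := g.mem_constraintSet_iff.1 hu
  constructor
  · rintro ⟨α, hα, rfl⟩
    refine ⟨α (liouville u) / c ^ 2, fun w => ?_⟩
    -- Because `dE_g ∘ J = θ_g` and `dE_g(Δ) = c²`, this multiple of `Δ` corrects `J w` to a tangent
    -- vector of `M`, on which `α` vanishes.
    have h1 : vertEndo u w - (g.oneForm u w / c ^ 2) • liouville u ∈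
        constraintTangent (g.constraint c) u := by
      rw [mem_constraintTangent_iff, map_sub, map_smul]
      have h2 : differential (𝓘(ℝ, E)).tangent g.energy u (vertEndo u w) = g.oneForm u w :=
        g.differential_energy_vertLift u (dproj u w)
      have h3 : differential (𝓘(ℝ, E)).tangent g.energy u (liouville u) = c ^ 2 :=
        (g.differential_energy_vertLift u u.snd).trans hu'
      rw [h2, h3, smul_eq_mul]
      field_simp
      ring
    have h4 := hα _ h1
    rw [map_sub, map_smul, smul_eq_mul] at h4
    change α (vertEndo u w) = _
    rw [sub_eq_zero.1 h4]
    ring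
  · rintro ⟨l, hl⟩
    -- The factor `1/2` compensates `ᵗJ ∘ dφ = 2θ_g`.
    refine ⟨(l / 2) • differential (𝓘(ℝ, E)).tangent (g.constraint c) u, ?_, ?_⟩
    · intro w hw
      have h1 : differential (𝓘(ℝ, E)).tangent (g.constraint c) u w = 0 := hw
      change l / 2 * differential (𝓘(ℝ, E)).tangent (g.constraint c) u w = 0
      rw [h1, mul_zero]
    · ext w
      rw [hl]
      change l / 2 * differential (𝓘(ℝ, E)).tangent (g.constraint c) u (vertLift u (dproj u w)) = _
      rw [g.differential_constraint_vertLift, g.oneForm_apply]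
      ring

/-- Passing to the quotient by the line of `θ_g` introduces a single Lagrange multiplier `l`. -/
theorem constrainedMap_eq_mk_iff (hc : 0 < c) {u : TB E Q}
    (hu : u ∈ constraintSet (g.constraint c)) (L : TB E Q → ℝ)
    (Z : constraintTangent (g.constraint c) u) (α : TTSp u →L[ℝ] ℝ) :
    constrainedMap L (g.constraint c) u Z = (constraintForces (g.constraint c) u).mkQ α ↔
      ∃ l : ℝ, ∀ w, lagrangeTwoForm L u Z w - α w = l * g.oneForm u w := by
  refine Iff.trans ?_ (g.mem_constraintForces_iff hc hu (β := lagrangeTwoForm L u Z - α))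
  exact Submodule.Quotient.eq (constraintForces (g.constraint c) u)

theorem twoForm_vertLift_right (u : TB E Q) (ξ : TSp E u.proj) (w : TTSp u) :
    g.twoForm u w (vertLift u ξ) = g.val u.proj ξ (dproj u w) := by
  rw [g.twoForm_neg_swap, g.twoForm_vertLift, neg_neg]

/-- The vertical part of the motion with factor `μ` on the geodesic field. -/
def verticalPart (U : Q → ℝ) (m e c μ : ℝ) (u : TB E Q) : TSp E u.proj :=
  (1 / m) • g.sharp u.proj (differential 𝓘(ℝ, E) U u.proj)
    - (1 / (m * c ^ 2) * differential 𝓘(ℝ, E) U u.proj u.snd) • u.snd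
    - (μ * (e / (m * c))) • g.sharp u.proj (extDerivOneForm 𝓘(ℝ, E) A.val u.proj u.snd)

theorem val_verticalPart (μ : ℝ) (u : TB E Q) (v : TSp E u.proj) :
    g.val u.proj (g.verticalPart A U m e c μ u) v =
      1 / m * differential 𝓘(ℝ, E) U u.proj v -
        1 / (m * c ^ 2) * differential 𝓘(ℝ, E) U u.proj u.snd * g.val u.proj u.snd v -
        μ * (e / (m * c)) * extDerivOneForm 𝓘(ℝ, E) A.val u.proj u.snd v := by
  simp only [verticalPart, map_sub, map_smul, sub_apply, smul_apply, smul_eq_mul, g.flat_sharp]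

/-- On `M` the speed is `c`, which turns `e v/(m c²)` into `e/(m c)`. -/
theorem verticalSolution_add_smul_sigmaField (hc : 0 < c) (μ : ℝ) {u : TB E Q}
    (hu : u ∈ constraintSet (g.constraint c)) :
    g.verticalSolution U m c u + μ • g.sigmaField A m e c u =
      μ • g.geodesicField u + vertLift u (g.verticalPart A U m e c μ u) := by
  have h : e * c / (m * c ^ 2) = e / (m * c) := by
    field_simp
  simp only [verticalSolution, sigmaField, verticalPart, gradVert, forceVert, liouville,
    speed_of_mem hc hu, map_sub, map_smul, h, smul_sub, smul_smul]
  abel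

theorem solution_eq (hc : 0 < c) {u : TB E Q} (hu : u ∈ constraintSet (g.constraint c)) :
    g.solution A U m e c u = g.verticalSolution U m c u + (1 : ℝ) • g.sigmaField A m e c u := by
  rw [verticalSolution_add_smul_sigmaField g A hc 1 hu]
  simp only [solution, verticalPart, gradVert, forceVert, liouville, map_sub, map_smul, one_smul,
    one_mul]
  abel

theorem extDeriv_self (A : SmoothOneForm E Q) (q : Q) (v : TSp E q) :
    extDerivOneForm 𝓘(ℝ, E) A.val q v v = 0 := by
  have h := extDerivOneForm_neg_swap A.val q v v
  linarith

variable [FiniteDimensional ℝ E]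

/-- This is the equation to which both systems reduce once `Tτ Z = μ u` is known. Removing `μ S_g`
leaves a vertical vector, hence an equation in `T_qQ` that nondegeneracy of `g` solves. -/
theorem eq_verticalSolution_add_iff (hm : 0 < m) (hc : 0 < c) {u : TB E Q}
    (hu : u ∈ constraintSet (g.constraint c)) (μ : ℝ) (Z : TTSp u) :
    (dproj u Z = μ • u.snd ∧ differential (𝓘(ℝ, E)).tangent g.energy u Z = 0 ∧
      ∃ l : ℝ, ∀ w, -m * g.twoForm u Z w + m * μ * differential (𝓘(ℝ, E)).tangent g.energy u w +
        μ * (e / c) * extDerivOneForm 𝓘(ℝ, E) A.val u.proj u.snd (dproj u w) -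
        differential 𝓘(ℝ, E) U u.proj (dproj u w) = l * g.oneForm u w) ↔
    Z = g.verticalSolution U m c u + μ • g.sigmaField A m e c u := by
  rw [verticalSolution_add_smul_sigmaField g A hc μ hu]
  have hu' := g.mem_constraintSet_iff.1 hu
  have hω : ∀ (η : TSp E u.proj) (w : TTSp u),
      g.twoForm u (μ • g.geodesicField u + vertLift u η) w =
        μ * differential (𝓘(ℝ, E)).tangent g.energy u w - g.val u.proj η (dproj u w) := by
    intro η w
    rw [map_add, map_smul, g.twoForm_geodesicField, add_apply, smul_apply, g.twoForm_vertLift,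
      smul_eq_mul]
    ring
  have hdE : ∀ η : TSp E u.proj, differential (𝓘(ℝ, E)).tangent g.energy u
      (μ • g.geodesicField u + vertLift u η) = g.val u.proj u.snd η := by
    intro η
    rw [map_add, map_smul, g.differential_energy_geodesicField, g.differential_energy_vertLift,
      smul_zero, zero_add]
  have hm' := hm.ne'
  have hc' := hc.ne'
  constructor
  · rintro ⟨h1, h2, l, h3⟩
    obtain ⟨η, hη⟩ : ∃ η, Z - μ • g.geodesicField u = vertLift u η := by
      refine exists_eq_vertLift ?_
      rw [map_sub, map_smul, h1, g.dproj_geodesicField, sub_self]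
    obtain rfl : Z = μ • g.geodesicField u + vertLift u η := by rw [← hη]; abel
    rw [hdE] at h2
    have h4 : ∀ v, m * g.val u.proj η v +
        μ * (e / c) * extDerivOneForm 𝓘(ℝ, E) A.val u.proj u.snd v -
        differential 𝓘(ℝ, E) U u.proj v = l * g.val u.proj u.snd v := by
      intro v
      obtain ⟨w, rfl⟩ := dproj_surjective u v
      have h5 := h3 w
      rw [hω, g.oneForm_apply] at h5
      linarith
    -- Evaluation at `u` determines the multiplier: tangency kills `g(η, u)`, skewness kills `F(u,
    -- u)`, and `g(u, u) = c²`.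
    have h6 := h4 u.snd
    rw [g.symm, h2, extDeriv_self, hu'] at h6
    have hl : l = - differential 𝓘(ℝ, E) U u.proj u.snd / c ^ 2 := by
      field_simp
      linarith
    congr 2
    refine g.ext_of_forall fun v => ?_
    rw [val_verticalPart]
    have h7 := h4 v
    rw [hl] at h7
    field_simp
    field_simp at h7
    linarith
  · rintro rfl
    refine ⟨?_, ?_, - differential 𝓘(ℝ, E) U u.proj u.snd / c ^ 2, fun w => ?_⟩
    · rw [map_add, map_smul, g.dproj_geodesicField, dproj_vertLift, add_zero]
    · rw [hdE, g.symm, val_verticalPart, extDeriv_self, hu']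
      field_simp
      ring
    · rw [hω, val_verticalPart, g.oneForm_apply]
      field_simp
      ring

theorem dproj_verticalSolution_add (hc : 0 < c) (μ : ℝ) {u : TB E Q}
    (hu : u ∈ constraintSet (g.constraint c)) :
    dproj u (g.verticalSolution U m c u + μ • g.sigmaField A m e c u) = μ • u.snd := by
  rw [verticalSolution_add_smul_sigmaField g A hc μ hu, map_add, map_smul, g.dproj_geodesicField,
    dproj_vertLift, add_zero]

/-- The equation of the constrained system of `L₂` at a point. -/
theorem constrainedMap_lagrangian₂_iff (hU : ContMDiff 𝓘(ℝ, E) 𝓘(ℝ, ℝ) ∞ U) (hm : 0 < m)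
    (hc : 0 < c) {u : TB E Q} (hu : u ∈ constraintSet (g.constraint c)) (Z : TTSp u) :
    (∃ h : Z ∈ constraintTangent (g.constraint c) u,
      constrainedMap (g.lagrangian₂ A U m e c) (g.constraint c) u ⟨Z, h⟩ =
        constrainedSection (g.lagrangian₂ A U m e c) (g.constraint c) u) ↔
    Z = g.solution A U m e c u := by
  rw [solution_eq g A hc hu, ← eq_verticalSolution_add_iff g A hm hc hu]
  constructor
  · rintro ⟨h, hZ⟩
    obtain ⟨l, hl⟩ := (g.constrainedMap_eq_mk_iff hc hu _ _ _).1 hZ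
    simp only [g.lagrangeTwoForm_lagrangian₂ A m e c hU,
      g.differential_lagrangeEnergy₂ A m e c hU] at hl
    -- Testing on vertical vectors removes the multiplier, the field and the potential, so every
    -- solution for `L₂` is second-order.
    have h1 : dproj u Z = u.snd := by
      refine g.ext_of_forall fun ξ => ?_
      have h2 := hl (vertLift u ξ)
      rw [g.twoForm_vertLift_right, g.differential_energy_vertLift, g.oneForm_apply,
        dproj_vertLift, map_zero, map_zero, map_zero] at h2
      rw [g.symm]
      have h3 : m * (g.val u.proj ξ (dproj u Z) - g.val u.proj u.snd ξ) = 0 := by linarith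
      linarith [(mul_eq_zero.1 h3).resolve_left hm.ne']
    refine ⟨h1.trans (one_smul _ _).symm, g.mem_constraintTangent_iff.1 h, l, fun w => ?_⟩
    rw [← hl w, h1]
    ring
  · rintro ⟨h1, h2, l, hl⟩
    rw [one_smul] at h1
    refine ⟨g.mem_constraintTangent_iff.2 h2,
      (g.constrainedMap_eq_mk_iff hc hu _ _ _).2 ⟨l, fun w => ?_⟩⟩
    rw [g.lagrangeTwoForm_lagrangian₂ A m e c hU, g.differential_lagrangeEnergy₂ A m e c hU,
      ← hl w, h1]
    ring

/-- The equation of the constrained system of `L₁` at a point. -/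
theorem constrainedMap_lagrangian₁_iff (hU : ContMDiff 𝓘(ℝ, E) 𝓘(ℝ, ℝ) ∞ U) (hm : 0 < m)
    (hc : 0 < c) {u : TB E Q} (hu : u ∈ constraintSet (g.constraint c)) (Z : TTSp u) :
    (∃ h : Z ∈ constraintTangent (g.constraint c) u,
      constrainedMap (g.lagrangian₁ A U m e c) (g.constraint c) u ⟨Z, h⟩ =
        constrainedSection (g.lagrangian₁ A U m e c) (g.constraint c) u) ↔
    Z = g.verticalSolution U m c u + (g.oneForm u Z / c ^ 2) • g.sigmaField A m e c u := by
  have hu' := g.mem_constraintSet_iff.1 hu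
  have hp := normSq_pos_of_mem hc hu
  have hs := sqrt_normSq_of_mem hc hu
  have hm' := hm.ne'
  have hc' := hc.ne'
  rw [← eq_verticalSolution_add_iff g A hm hc hu]
  constructor
  · rintro ⟨h, hZ⟩
    obtain ⟨l, hl⟩ := (g.constrainedMap_eq_mk_iff hc hu _ _ _).1 hZ
    have h0 := g.mem_constraintTangent_iff.1 h
    simp only [g.lagrangeTwoForm_lagrangian₁ A m e c hU hp,
      g.differential_lagrangeEnergy₁ A m e c hU hp, hs, h0] at hl
    -- The same test for `L₁` makes `Tτ Z` proportional to `u`. Pairing with `u` only reproduces the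
    -- definition of the factor, which therefore stays free.
    have h1 : dproj u Z = (g.oneForm u Z / c ^ 2) • u.snd := by
      refine g.ext_of_forall fun ξ => ?_
      have h2 := hl (vertLift u ξ)
      rw [g.twoForm_vertLift_right, g.differential_energy_vertLift, g.oneForm_apply u (vertLift u ξ),
        dproj_vertLift, map_zero, map_zero, map_zero] at h2
      rw [map_smul, smul_apply, smul_eq_mul, g.symm]
      field_simp at h2 ⊢
      have h3 : m * (c ^ 2 * g.val u.proj ξ (dproj u Z) -
          g.val u.proj u.snd ξ * g.oneForm u Z) = 0 := by linarith
      linarith [(mul_eq_zero.1 h3).resolve_left hm']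
    refine ⟨h1, h0, l, fun w => ?_⟩
    rw [← hl w]
    have h3 : extDerivOneForm 𝓘(ℝ, E) A.val u.proj (dproj u Z) (dproj u w) =
        g.oneForm u Z / c ^ 2 * extDerivOneForm 𝓘(ℝ, E) A.val u.proj u.snd (dproj u w) := by
      rw [h1, map_smul, smul_apply, smul_eq_mul]
    rw [h3]
    field_simp
    ring
  · rintro ⟨h1, h2, l, hl⟩
    refine ⟨g.mem_constraintTangent_iff.2 h2,
      (g.constrainedMap_eq_mk_iff hc hu _ _ _).2 ⟨l, fun w => ?_⟩⟩
    rw [g.lagrangeTwoForm_lagrangian₁ A m e c hU hp, g.differential_lagrangeEnergy₁ A m e c hU hp,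
      ← hl w, hs]
    have h3 : extDerivOneForm 𝓘(ℝ, E) A.val u.proj (dproj u Z) (dproj u w) =
        g.oneForm u Z / c ^ 2 * extDerivOneForm 𝓘(ℝ, E) A.val u.proj u.snd (dproj u w) := by
      rw [h1, map_smul, smul_apply, smul_eq_mul]
    simp only [h2, h3]
    field_simp
    ring

theorem oneForm_verticalSolution_add (hc : 0 < c) (μ : ℝ) {u : TB E Q}
    (hu : u ∈ constraintSet (g.constraint c)) :
    g.oneForm u (g.verticalSolution U m c u + μ • g.sigmaField A m e c u) / c ^ 2 = μ := by
  rw [g.oneForm_apply, dproj_verticalSolution_add g A hc μ hu, map_smul,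
    g.mem_constraintSet_iff.1 hu, smul_eq_mul]
  field_simp

/-! ### Regularity for `L₂` and degeneracy for `L₁`. -/

theorem lagrangeTwoForm_lagrangian₂_vertLift (hU : ContMDiff 𝓘(ℝ, E) 𝓘(ℝ, ℝ) ∞ U)
    (u : TB E Q) (ξ : TSp E u.proj) (w : TTSp u) :
    lagrangeTwoForm (g.lagrangian₂ A U m e c) u (vertLift u ξ) w =
      m * g.val u.proj ξ (dproj u w) := by
  rw [g.lagrangeTwoForm_lagrangian₂ A m e c hU, g.twoForm_vertLift, dproj_vertLift, map_zero,
    zero_apply]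
  ring

theorem lagrangeTwoForm_lagrangian₂_bijective (hU : ContMDiff 𝓘(ℝ, E) 𝓘(ℝ, ℝ) ∞ U) (hm : 0 < m)
    (u : TB E Q) : Function.Bijective (lagrangeTwoForm (g.lagrangian₂ A U m e c) u) :=
  bijective_of_bilin_injective (V := E × E) (g.injective_of_vertLift hm.ne'
    (fun w w' => congrArg Neg.neg (extDerivOneForm_neg_swap _ u w w'))
    (g.lagrangeTwoForm_lagrangian₂_vertLift A hU u))

theorem isRegularConstrained_lagrangian₂ (hU : ContMDiff 𝓘(ℝ, E) 𝓘(ℝ, ℝ) ∞ U) (hm : 0 < m)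
    (hc : 0 < c) : IsRegularConstrained (g.lagrangian₂ A U m e c) (g.constraint c) := by
  intro u hu
  have hu' := g.mem_constraintSet_iff.1 hu
  constructor
  · refine (injective_iff_map_eq_zero _).2 fun Z hZ => ?_
    -- Adding a kernel vector to the value of `X` gives another solution of the same affine
    -- equation, which has only one.
    obtain ⟨h, hX⟩ := (g.constrainedMap_lagrangian₂_iff A hU hm hc hu _).2 rfl
    have h1 := (g.constrainedMap_lagrangian₂_iff A hU hm hc hu (g.solution A U m e c u + Z)).1
      ⟨Submodule.add_mem _ h Z.2, by
        refine Eq.trans (map_add _ ⟨_, h⟩ Z) ?_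
        rw [hX, hZ, add_zero]⟩
    exact Subtype.ext (add_eq_left.1 h1)
  · intro y
    obtain ⟨α, rfl⟩ := (constraintForces (g.constraint c) u).mkQ_surjective y
    -- A class is represented by `i_Z ω_{L₂}`. Subtracting `t Δ` with `t = dE_g(Z)/c²` makes `Z`
    -- tangent to `M`, and does not change the class because `i_Δ ω_{L₂} = m θ_g`.
    obtain ⟨Z, rfl⟩ := (g.lagrangeTwoForm_lagrangian₂_bijective A (e := e) (c := c) hU hm u).2 α
    obtain ⟨t, ht⟩ : ∃ t, t = differential (𝓘(ℝ, E)).tangent g.energy u Z / c ^ 2 := ⟨_, rfl⟩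
    have h1 : Z - t • liouville u ∈ constraintTangent (g.constraint c) u := by
      have h3 : differential (𝓘(ℝ, E)).tangent g.energy u (liouville u) = c ^ 2 :=
        (g.differential_energy_vertLift u u.snd).trans hu'
      rw [mem_constraintTangent_iff, map_sub, map_smul, h3, ht, smul_eq_mul]
      field_simp
      ring
    refine ⟨⟨_, h1⟩, (g.constrainedMap_eq_mk_iff hc hu _ _ _).2 ⟨-(t * m), fun w => ?_⟩⟩
    have h2 := g.lagrangeTwoForm_lagrangian₂_vertLift A (m := m) (e := e) (c := c) hU u u.snd w
    change lagrangeTwoForm _ u (Z - t • vertLift u u.snd) w - _ = _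
    rw [map_sub, map_smul, sub_apply, smul_apply, h2, g.oneForm_apply, smul_eq_mul]
    ring

/-- The Liouville vector is in the kernel: the terms in `ω_g` and in `dE_g ∧ θ_g` cancel since
`dE_g(Δ) = v²`. It is nonzero because `u` is. -/
theorem lagrangeTwoForm_lagrangian₁_not_injective (hU : ContMDiff 𝓘(ℝ, E) 𝓘(ℝ, ℝ) ∞ U)
    (u : TB E Q) (hu : 0 < g.normSq u) :
    ¬ Function.Injective (lagrangeTwoForm (g.lagrangian₁ A U m e c) u) := by
  intro h
  have hs : Real.sqrt (g.normSq u) ≠ 0 := (Real.sqrt_pos.2 hu).ne'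
  have h1 : g.val u.proj u.snd u.snd = Real.sqrt (g.normSq u) ^ 2 := (Real.sq_sqrt hu.le).symm
  have h2 : lagrangeTwoForm (g.lagrangian₁ A U m e c) u (vertLift u u.snd) = 0 := by
    ext w
    rw [g.lagrangeTwoForm_lagrangian₁ A m e c hU hu, g.twoForm_vertLift,
      g.differential_energy_vertLift, h1, g.oneForm_apply, g.oneForm_apply, dproj_vertLift,
      map_zero, map_zero, zero_apply, zero_apply]
    field_simp
    ring
  have h3 := (injective_iff_map_eq_zero _).1 (vertLift_injective u) _
    ((injective_iff_map_eq_zero _).1 h _ h2)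
  rw [h3, map_zero] at h1
  exact (pow_ne_zero 2 hs) h1.symm

/-- The values `μ = 0` and `μ = 1` give two solutions at `u`, told apart by `θ_g`. -/
theorem constrainedMap_lagrangian₁_not_bijective (hU : ContMDiff 𝓘(ℝ, E) 𝓘(ℝ, ℝ) ∞ U) (hm : 0 < m)
    (hc : 0 < c) {u : TB E Q} (hu : u ∈ constraintSet (g.constraint c)) :
    ¬ Function.Bijective (constrainedMap (g.lagrangian₁ A U m e c) (g.constraint c) u) := by
  intro h
  have h1 : ∀ μ : ℝ, _ := fun μ => (g.constrainedMap_lagrangian₁_iff A hU hm hc hu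
    (g.verticalSolution U m c u + μ • g.sigmaField A m e c u)).2
    (by rw [oneForm_verticalSolution_add g A hc μ hu])
  obtain ⟨h2, h3⟩ := h1 0
  obtain ⟨h4, h5⟩ := h1 1
  have h6 := congrArg Subtype.val (h.1 (h3.trans h5.symm))
  have h7 := congrArg (fun Z => g.oneForm u Z / c ^ 2) h6
  simp only [oneForm_verticalSolution_add g A hc _ hu] at h7
  exact zero_ne_one h7

end LorentzMetric

/-! ### Smoothness of vector fields on `TQ` in charts. -/

section SmoothFields

variable {E : Type*} [NormedAddCommGroup E] [NormedSpace ℝ E]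
  {Q : Type*} [TopologicalSpace Q] [ChartedSpace E Q] [IsManifold 𝓘(ℝ, E) ∞ Q]

/-- Smoothness at `u` within `s` of a vector field on `TQ`, in the chart at `u`. -/
def SmoothFieldWithinAt (s : Set (TB E Q)) (X : ∀ u : TB E Q, TTSp u) (u₀ : TB E Q) : Prop :=
  ContMDiffWithinAt (𝓘(ℝ, E)).tangent 𝓘(ℝ, E × E) ∞ (fun u => tangentChartDeriv u₀ u (X u)) s u₀

theorem isSmoothFieldOn_iff {s : Set (TB E Q)} {X : ∀ u : TB E Q, TTSp u} :
    IsSmoothFieldOn s X ↔ ∀ u ∈ s, SmoothFieldWithinAt s X u :=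
  forall₂_congr fun _ _ => contMDiffWithinAt_field_iff

theorem IsSmoothFieldOn.congr {s : Set (TB E Q)} {X Y : ∀ u : TB E Q, TTSp u}
    (hX : IsSmoothFieldOn s X) (h : ∀ u ∈ s, Y u = X u) : IsSmoothFieldOn s Y :=
  ContMDiffOn.congr hX fun u hu => by rw [h u hu]

variable {s : Set (TB E Q)} {X Y : ∀ u : TB E Q, TTSp u} {u₀ : TB E Q}

theorem SmoothFieldWithinAt.add (hX : SmoothFieldWithinAt s X u₀)
    (hY : SmoothFieldWithinAt s Y u₀) : SmoothFieldWithinAt s (fun u => X u + Y u) u₀ :=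
  ContMDiffWithinAt.congr (ContMDiffWithinAt.add hX hY)
    (fun u _ => map_add (tangentChartDeriv u₀ u) (X u : E × E) (Y u : E × E))
    (map_add (tangentChartDeriv u₀ u₀) (X u₀ : E × E) (Y u₀ : E × E))

theorem SmoothFieldWithinAt.smul {f : TB E Q → ℝ}
    (hf : ContMDiffWithinAt (𝓘(ℝ, E)).tangent 𝓘(ℝ, ℝ) ∞ f s u₀)
    (hX : SmoothFieldWithinAt s X u₀) : SmoothFieldWithinAt s (fun u => f u • X u) u₀ :=
  ContMDiffWithinAt.congr (ContMDiffWithinAt.smul hf hX)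
    (fun u _ => map_smul (tangentChartDeriv u₀ u) (f u) (X u : E × E))
    (map_smul (tangentChartDeriv u₀ u₀) (f u₀) (X u₀ : E × E))

theorem SmoothFieldWithinAt.sub (hX : SmoothFieldWithinAt s X u₀)
    (hY : SmoothFieldWithinAt s Y u₀) : SmoothFieldWithinAt s (fun u => X u - Y u) u₀ :=
  ContMDiffWithinAt.congr (ContMDiffWithinAt.sub hX hY)
    (fun u _ => map_sub (tangentChartDeriv u₀ u) (X u : E × E) (Y u : E × E))
    (map_sub (tangentChartDeriv u₀ u₀) (X u₀ : E × E) (Y u₀ : E × E))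

theorem SmoothFieldWithinAt.const_smul (r : ℝ)
    (hX : SmoothFieldWithinAt s X u₀) : SmoothFieldWithinAt s (fun u => r • X u) u₀ :=
  hX.smul (f := fun _ => r) contMDiffWithinAt_const

/-- A field on `TQ` is smooth if its local expression is. -/
theorem smoothFieldWithinAt_of_tangentChart {f : E × E → E × E}
    (hf : ContDiffAt ℝ ∞ f (extChartAt (𝓘(ℝ, E)).tangent u₀ u₀))
    (h : ∀ u : TB E Q, u.proj ∈ (extChartAt 𝓘(ℝ, E) u₀.proj).source →
      tangentChartDeriv u₀ u (X u) =
        f (extChartAt 𝓘(ℝ, E) u₀.proj u.proj, chartDeriv E u₀.proj u.proj u.snd)) :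
    SmoothFieldWithinAt s X u₀ :=
  (contMDiffAt_of_tangentChart hf h).contMDiffWithinAt

theorem smoothFieldWithinAt_liouville : SmoothFieldWithinAt s (fun u => liouville u) u₀ := by
  refine smoothFieldWithinAt_of_tangentChart (f := fun z => (0, z.2))
    (contDiffAt_const.prodMk contDiffAt_snd) fun u hu => ?_
  exact tangentChartDeriv_vertLift hu u.snd

theorem inverse_eq_of_injective {V : Type*} [NormedAddCommGroup V] [NormedSpace ℝ V]
    [FiniteDimensional ℝ V] {B : V →L[ℝ] V →L[ℝ] ℝ} (h : Function.Injective B) {x : V}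
    {α : V →L[ℝ] ℝ} (hx : ∀ y, B x y = α y) : x = B.inverse α :=
  h ((ContinuousLinearMap.ext hx).trans (apply_inverse_of_bilin_injective h α).symm)

/-- Inversion is smooth at invertible operators; in finite dimension injectivity of the form
suffices. -/
theorem contDiffAt_inverse_apply {V W : Type*} [NormedAddCommGroup V] [NormedSpace ℝ V]
    [FiniteDimensional ℝ V] [NormedAddCommGroup W] [NormedSpace ℝ W] {B : W → V →L[ℝ] V →L[ℝ] ℝ}
    {α : W → V →L[ℝ] ℝ} {z : W} (hB : ContDiffAt ℝ ∞ B z) (hα : ContDiffAt ℝ ∞ α z)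
    (h : Function.Injective (B z)) : ContDiffAt ℝ ∞ (fun z => (B z).inverse (α z)) z := by
  have : CompleteSpace V := FiniteDimensional.complete ℝ V
  have h1 : (B z).IsInvertible := exists_equiv_of_injective h
  exact ContDiffAt.clm_apply (ContDiffAt.comp z h1.contDiffAt_map_inverse hB) hα

namespace LorentzMetric

variable (g : LorentzMetric E Q)

theorem inChart_injective {q₀ q : Q} (hq : q ∈ (extChartAt 𝓘(ℝ, E) q₀).source) :
    Function.Injective (g.inChart q₀ (extChartAt 𝓘(ℝ, E) q₀ q)) := by
  refine (injective_iff_map_eq_zero _).2 fun h hh => ?_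
  have hs : chartDeriv E q₀ q (chartDerivSymm E q₀ (extChartAt 𝓘(ℝ, E) q₀ q) h) = h := by
    have := chartDeriv_chartDerivSymm ((extChartAt 𝓘(ℝ, E) q₀).map_source hq) h
    rwa [(extChartAt 𝓘(ℝ, E) q₀).left_inv hq] at this
  obtain ⟨v, hv⟩ : ∃ v : TSp E q, v = chartDerivSymm E q₀ (extChartAt 𝓘(ℝ, E) q₀ q) h := ⟨_, rfl⟩
  rw [← hv] at hs
  have h1 : v = 0 := by
    refine g.eq_zero_of_forall fun w => ?_
    rw [← g.inChart_chartDeriv hq, hs, hh]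
    rfl
  rw [← hs, h1]
  exact map_zero (chartDeriv E q₀ q)

variable [FiniteDimensional ℝ E]

/-- In a chart `♯` is the inverse of the coordinate metric, so it is enough that the covector has a
smooth expression. -/
theorem smoothFieldWithinAt_vertLift_sharp {α : ∀ u : TB E Q, TSp E u.proj →L[ℝ] ℝ}
    {α' : E × E → E →L[ℝ] ℝ} (hα' : ContDiffAt ℝ ∞ α' (extChartAt (𝓘(ℝ, E)).tangent u₀ u₀))
    (h : ∀ u : TB E Q, u.proj ∈ (extChartAt 𝓘(ℝ, E) u₀.proj).source → ∀ v : TSp E u.proj,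
      α u v = α' (extChartAt 𝓘(ℝ, E) u₀.proj u.proj, chartDeriv E u₀.proj u.proj u.snd)
        (chartDeriv E u₀.proj u.proj v)) :
    SmoothFieldWithinAt s (fun u => vertLift u (g.sharp u.proj (α u))) u₀ := by
  have h0 := mem_extChartAt_source (I := 𝓘(ℝ, E)) u₀.proj
  refine smoothFieldWithinAt_of_tangentChart
    (f := fun z => (0, (g.inChart u₀.proj z.1).inverse (α' z)))
    (contDiffAt_const.prodMk (contDiffAt_inverse_apply ?_ hα' ?_)) fun u hu => ?_
  · exact (g.contDiffAt_inChart (fst_tangentChart_mem u₀)).comp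
      (extChartAt (𝓘(ℝ, E)).tangent u₀ u₀) contDiffAt_fst
  · exact g.inChart_injective h0
  · rw [tangentChartDeriv_vertLift hu]
    refine congrArg (Prod.mk 0) (inverse_eq_of_injective (g.inChart_injective hu) fun w => ?_)
    have hs : chartDeriv E u₀.proj u.proj
        (chartDerivSymm E u₀.proj (extChartAt 𝓘(ℝ, E) u₀.proj u.proj) w) = w := by
      have := chartDeriv_chartDerivSymm ((extChartAt 𝓘(ℝ, E) u₀.proj).map_source hu) w
      rwa [(extChartAt 𝓘(ℝ, E) u₀.proj).left_inv hu] at this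
    obtain ⟨v, hv⟩ : ∃ v : TSp E u.proj,
      v = chartDerivSymm E u₀.proj (extChartAt 𝓘(ℝ, E) u₀.proj u.proj) w := ⟨_, rfl⟩
    rw [← hv] at hs
    rw [← hs, g.inChart_chartDeriv hu, g.flat_sharp]
    exact h u hu v

theorem contDiffAt_potentialInChart {U : Q → ℝ} (hU : ContMDiff 𝓘(ℝ, E) 𝓘(ℝ, ℝ) ∞ U) {q₀ : Q}
    {y : E} (hy : y ∈ (extChartAt 𝓘(ℝ, E) q₀).target) :
    ContDiffAt ℝ ∞ (U ∘ (extChartAt 𝓘(ℝ, E) q₀).symm) y :=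
  contDiffAt_of_section hy (hU _) fun _ _ => rfl

theorem differential_eq_fderiv {U : Q → ℝ} (hU : ContMDiff 𝓘(ℝ, E) 𝓘(ℝ, ℝ) ∞ U) {q₀ q : Q}
    (hq : q ∈ (extChartAt 𝓘(ℝ, E) q₀).source) (v : TSp E q) :
    differential 𝓘(ℝ, E) U q v = fderiv ℝ (U ∘ (extChartAt 𝓘(ℝ, E) q₀).symm)
      (extChartAt 𝓘(ℝ, E) q₀ q) (chartDeriv E q₀ q v) := by
  have h1 : HasFDerivAt (U ∘ (extChartAt 𝓘(ℝ, E) q₀).symm) _ (extChartAt 𝓘(ℝ, E) q₀ q) :=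
    ((contDiffAt_potentialInChart hU ((extChartAt 𝓘(ℝ, E) q₀).map_source hq)).differentiableAt
      (by simp)).hasFDerivAt
  have h2 := h1.hasMFDerivAt.comp q (mdifferentiableAt_extChartAt_of_mem hq).hasMFDerivAt
  have h3 : U =ᶠ[𝓝 q] (U ∘ (extChartAt 𝓘(ℝ, E) q₀).symm) ∘ extChartAt 𝓘(ℝ, E) q₀ := by
    filter_upwards [(isOpen_extChartAt_source (I := 𝓘(ℝ, E)) q₀).mem_nhds hq] with p hp
    exact congrArg U ((extChartAt 𝓘(ℝ, E) q₀).left_inv hp).symm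
  exact DFunLike.congr_fun (h2.congr_of_eventuallyEq h3).mfderiv v

theorem contMDiff_differential_apply {U : Q → ℝ} (hU : ContMDiff 𝓘(ℝ, E) 𝓘(ℝ, ℝ) ∞ U) :
    ContMDiff (𝓘(ℝ, E)).tangent 𝓘(ℝ, ℝ) ∞
      (fun u : TB E Q => differential 𝓘(ℝ, E) U u.proj u.snd) := by
  intro u₀
  refine contMDiffAt_of_tangentChart
    (f' := fun z => fderiv ℝ (U ∘ (extChartAt 𝓘(ℝ, E) u₀.proj).symm) z.1 z.2) ?_
    fun u hu => differential_eq_fderiv hU hu u.snd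
  have h := (contDiffAt_potentialInChart hU (fst_tangentChart_mem u₀)).fderiv_right (m := ∞)
    (by simp)
  exact (h.comp (extChartAt (𝓘(ℝ, E)).tangent u₀ u₀) contDiffAt_fst).clm_apply contDiffAt_snd

theorem smoothFieldWithinAt_gradVert {U : Q → ℝ} (hU : ContMDiff 𝓘(ℝ, E) 𝓘(ℝ, ℝ) ∞ U) :
    SmoothFieldWithinAt s (g.gradVert U) u₀ := by
  refine g.smoothFieldWithinAt_vertLift_sharp
    (α' := fun z => fderiv ℝ (U ∘ (extChartAt 𝓘(ℝ, E) u₀.proj).symm) z.1) ?_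
    fun u hu v => differential_eq_fderiv hU hu v
  have h := (contDiffAt_potentialInChart hU (fst_tangentChart_mem u₀)).fderiv_right (m := ∞)
    (by simp)
  exact h.comp (extChartAt (𝓘(ℝ, E)).tangent u₀ u₀) contDiffAt_fst

theorem contDiffAt_flip {V W : Type*} [NormedAddCommGroup V] [NormedSpace ℝ V]
    [NormedAddCommGroup W] [NormedSpace ℝ W] {B : W → V →L[ℝ] V →L[ℝ] ℝ} {z : W}
    (hB : ContDiffAt ℝ ∞ B z) : ContDiffAt ℝ ∞ (fun z => (B z).flip) z := by
  have h : ContDiff ℝ ∞ (fun B : V →L[ℝ] V →L[ℝ] ℝ => B.flip) :=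
    IsBoundedLinearMap.contDiff (IsLinearMap.with_bound
      ⟨fun _ _ => rfl, fun _ _ => rfl⟩ 1 fun B => by rw [B.opNorm_flip, one_mul])
  exact h.contDiffAt.comp z hB

theorem smoothFieldWithinAt_forceVert (A : SmoothOneForm E Q) :
    SmoothFieldWithinAt s (g.forceVert A) u₀ := by
  refine g.smoothFieldWithinAt_vertLift_sharp
    (α' := fun z => (fderiv ℝ (oneFormInChart 𝓘(ℝ, E) A.val u₀.proj) z.1 -
      (fderiv ℝ (oneFormInChart 𝓘(ℝ, E) A.val u₀.proj) z.1).flip) z.2) ?_ fun u hu v => ?_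
  · have h := (A.contDiffAt_inChart (fst_tangentChart_mem u₀)).fderiv_right (m := ∞) (by simp)
    exact ((h.sub (contDiffAt_flip h)).comp (extChartAt (𝓘(ℝ, E)).tangent u₀ u₀)
      contDiffAt_fst).clm_apply contDiffAt_snd
  · exact extDerivOneForm_eq_of_mem_source A.val hu ((A.contDiffAt_inChart
      ((extChartAt 𝓘(ℝ, E) u₀.proj).map_source hu)).differentiableAt (by simp))
      (κ := chartDeriv E u₀.proj u.proj) rfl u.snd v

/-- In one fixed chart of `TQ`, `S_g` is the inverse of the expression of `ω_g` applied to the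
derivative `en'` of the energy expression `en`. -/
theorem smoothFieldWithinAt_geodesicField : SmoothFieldWithinAt s g.geodesicField u₀ := by
  set en : E × E → ℝ := fun z => 1 / 2 * g.inChart u₀.proj z.1 z.2 z.2
  have hE : ∀ z : E × E, z.1 ∈ (extChartAt 𝓘(ℝ, E) u₀.proj).target → ContDiffAt ℝ ∞ en z := by
    intro z hz
    have h := (g.contDiffAt_inChart hz).comp z contDiffAt_fst
    exact contDiffAt_const.mul ((h.clm_apply contDiffAt_snd).clm_apply contDiffAt_snd)
  have hκ : ∀ u : TB E Q, u.proj ∈ (extChartAt 𝓘(ℝ, E) u₀.proj).source → ∀ h : E × E,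
      ∃ w : TTSp u, tangentChartDeriv u₀ u w = h := by
    intro u hu h
    have hu' := mem_tangentChart_source.2 hu
    have h1 := tangentChartDeriv_symm ((extChartAt (𝓘(ℝ, E)).tangent u₀).map_source hu') h
    rw [(extChartAt (𝓘(ℝ, E)).tangent u₀).left_inv hu'] at h1
    exact ⟨_, h1⟩
  have hinj : ∀ u : TB E Q, u.proj ∈ (extChartAt 𝓘(ℝ, E) u₀.proj).source →
      Function.Injective (g.twoFormInChart u₀ (extChartAt (𝓘(ℝ, E)).tangent u₀ u)) := by
    intro u hu
    refine (injective_iff_map_eq_zero _).2 fun h hh => ?_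
    obtain ⟨w, rfl⟩ := hκ u hu h
    have h1 : w = 0 := by
      refine (injective_iff_map_eq_zero _).1 (g.twoForm_injective u) w ?_
      ext w'
      rw [g.twoForm_eq_twoFormInChart hu, hh]
      rfl
    rw [h1]
    exact map_zero (tangentChartDeriv u₀ u)
  refine smoothFieldWithinAt_of_tangentChart
    (f := fun z => (g.twoFormInChart u₀ z).inverse (fderiv ℝ en z))
    (contDiffAt_inverse_apply ?_ ((hE _ (fst_tangentChart_mem u₀)).fderiv_right (by simp))
      (hinj u₀ (mem_extChartAt_source u₀.proj))) fun u hu => ?_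
  · have h := (g.contDiffAt_oneFormInChart (fst_tangentChart_mem u₀)).fderiv_right (m := ∞)
      (by simp)
    exact (contDiffAt_flip h).sub h
  · rw [← tangentChart_apply hu]
    refine inverse_eq_of_injective (hinj u hu) fun h => ?_
    obtain ⟨w, rfl⟩ := hκ u hu h
    rw [← g.twoForm_eq_twoFormInChart hu, g.twoForm_geodesicField]
    have hu' := mem_tangentChart_source.2 hu
    have hz := mem_tangentChart_target.1 ((extChartAt (𝓘(ℝ, E)).tangent u₀).map_source hu')
    have h1 : HasFDerivAt en _ (extChartAt (𝓘(ℝ, E)).tangent u₀ u) :=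
      ((hE _ hz).differentiableAt (by simp)).hasFDerivAt
    have h2 := h1.hasMFDerivAt.comp u (mdifferentiableAt_extChartAt_of_mem hu').hasMFDerivAt
    have h3 : g.energy =ᶠ[𝓝 u] en ∘ extChartAt (𝓘(ℝ, E)).tangent u₀ := by
      filter_upwards [(isOpen_extChartAt_source (I := (𝓘(ℝ, E)).tangent) u₀).mem_nhds hu']
        with p hp
      have hp' := mem_tangentChart_source.1 hp
      rw [Function.comp_apply, tangentChart_apply hp']
      exact congrArg (1 / 2 * ·) (g.inChart_chartDeriv hp' p.snd p.snd).symm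
    exact DFunLike.congr_fun (h2.congr_of_eventuallyEq h3).mfderiv w

/-- The value of `θ_g` on a smooth vector field is smooth. -/
theorem contMDiffOn_oneForm_apply (hX : IsSmoothFieldOn s X) :
    ContMDiffOn (𝓘(ℝ, E)).tangent 𝓘(ℝ, ℝ) ∞ (fun u => g.oneForm u (X u)) s := by
  intro u₀ hu₀
  have h1 := isSmoothFieldOn_iff.1 hX u₀ hu₀
  have h2 : ContMDiffAt (𝓘(ℝ, E)).tangent 𝓘(ℝ, E →L[ℝ] ℝ) ∞
      (fun u => g.inChart u₀.proj (extChartAt (𝓘(ℝ, E)).tangent u₀ u).1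
        (extChartAt (𝓘(ℝ, E)).tangent u₀ u).2) u₀ := by
    have h3 : ContDiffAt ℝ ∞ (fun z : E × E => g.inChart u₀.proj z.1 z.2)
        (extChartAt (𝓘(ℝ, E)).tangent u₀ u₀) :=
      ((g.contDiffAt_inChart (fst_tangentChart_mem u₀)).comp
        (extChartAt (𝓘(ℝ, E)).tangent u₀ u₀) contDiffAt_fst).clm_apply contDiffAt_snd
    exact h3.contMDiffAt.comp u₀ contMDiffAt_extChartAt
  have h4 : ContMDiffWithinAt (𝓘(ℝ, E)).tangent 𝓘(ℝ, E) ∞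
      (fun u => (tangentChartDeriv u₀ u (X u)).1) s u₀ :=
    (contDiffAt_fst (𝕜 := ℝ) (E := E) (F := E) (n := ∞)).contMDiffAt.comp_contMDiffWithinAt u₀ h1
  have h5 : ∀ u : TB E Q, u.proj ∈ (extChartAt 𝓘(ℝ, E) u₀.proj).source →
      g.oneForm u (X u) = g.inChart u₀.proj (extChartAt (𝓘(ℝ, E)).tangent u₀ u).1
        (extChartAt (𝓘(ℝ, E)).tangent u₀ u).2 (tangentChartDeriv u₀ u (X u)).1 := by
    intro u hu
    rw [← chartDeriv_dproj hu, tangentChart_apply hu]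
    exact (g.inChart_chartDeriv hu u.snd (dproj u (X u))).symm
  refine (h2.contMDiffWithinAt.clm_apply h4).congr_of_eventuallyEq ?_
    (h5 u₀ (mem_extChartAt_source u₀.proj))
  filter_upwards [mem_nhdsWithin_of_mem_nhds ((isOpen_extChartAt_source
    (I := (𝓘(ℝ, E)).tangent) u₀).mem_nhds (mem_extChartAt_source u₀))] with u hu
  exact h5 u (mem_tangentChart_source.1 hu)

end LorentzMetric

end SmoothFields

/-! ### Solutions as smooth fields on `M`. -/

namespace LorentzMetric

variable {E : Type*} [NormedAddCommGroup E] [NormedSpace ℝ E] [FiniteDimensional ℝ E]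
  {Q : Type*} [TopologicalSpace Q] [ChartedSpace E Q] [IsManifold 𝓘(ℝ, E) ∞ Q]
  (g : LorentzMetric E Q) (A : SmoothOneForm E Q) {U : Q → ℝ} {m e c : ℝ}

/-- The time-like unit vector of an orthonormal basis is scaled by `c`. -/
theorem exists_mem_constraintSet (c : ℝ) (q : Q) :
    ∃ u ∈ constraintSet (g.constraint c), u.proj = q := by
  obtain ⟨b, hb⟩ := g.signature q
  refine ⟨⟨q, c • b 0⟩, g.mem_constraintSet_iff.2 ?_, rfl⟩
  change g.val q (c • b 0) (c • b 0) = c ^ 2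
  rw [map_smul, map_smul, smul_apply, hb]
  simp [sq]

theorem differential_constraint_comp_vertEndo_ne_zero (hc : 0 < c) {u : TB E Q}
    (hu : u ∈ constraintSet (g.constraint c)) :
    (differential (𝓘(ℝ, E)).tangent (g.constraint c) u).comp (vertEndo u) ≠ 0 := by
  intro h
  obtain ⟨w, hw⟩ := dproj_surjective u u.snd
  have h1 : differential (𝓘(ℝ, E)).tangent (g.constraint c) u (vertLift u (dproj u w)) = 0 :=
    DFunLike.congr_fun h w
  rw [g.differential_constraint_vertLift, hw, g.mem_constraintSet_iff.1 hu] at h1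
  have := pow_pos hc 2
  linarith

/-- The fields `Y + μ Σ` are smooth on `M`. -/
theorem isSmoothFieldOn_verticalSolution_add (hU : ContMDiff 𝓘(ℝ, E) 𝓘(ℝ, ℝ) ∞ U) (hc : 0 < c)
    {μ : TB E Q → ℝ}
    (hμ : ContMDiffOn (𝓘(ℝ, E)).tangent 𝓘(ℝ, ℝ) ∞ μ (constraintSet (g.constraint c))) :
    IsSmoothFieldOn (constraintSet (g.constraint c))
      (fun u => g.verticalSolution U m c u + μ u • g.sigmaField A m e c u) := by
  -- Replacing the speed by its constant value `c` on `M` avoids differentiating the square root.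
  have h : IsSmoothFieldOn (constraintSet (g.constraint c)) (fun u =>
      ((1 / m) • g.gradVert U u
        - (1 / (m * c ^ 2) * differential 𝓘(ℝ, E) U u.proj u.snd) • liouville u) +
      μ u • (g.geodesicField u - (e * c / (m * c ^ 2)) • g.forceVert A u)) := by
    refine isSmoothFieldOn_iff.2 fun u hu => ?_
    refine SmoothFieldWithinAt.add (.sub ?_ ?_) (.smul (hμ u hu) (.sub ?_ ?_))
    · exact (g.smoothFieldWithinAt_gradVert hU).const_smul _
    · exact smoothFieldWithinAt_liouville.smul
        ((contMDiff_const.mul (contMDiff_differential_apply hU)).contMDiffAt.contMDiffWithinAt)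
    · exact g.smoothFieldWithinAt_geodesicField
    · exact (g.smoothFieldWithinAt_forceVert A).const_smul _
  refine h.congr fun u hu => ?_
  simp only [verticalSolution, sigmaField, speed_of_mem hc hu]

theorem isConstrainedSolution_lagrangian₂_iff (hU : ContMDiff 𝓘(ℝ, E) 𝓘(ℝ, ℝ) ∞ U) (hm : 0 < m)
    (hc : 0 < c) (Z : ∀ u : TB E Q, TTSp u) :
    IsConstrainedSolution (g.lagrangian₂ A U m e c) (g.constraint c) Z ↔
      ∀ u ∈ constraintSet (g.constraint c), Z u = g.solution A U m e c u := by
  constructor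
  · intro h u hu
    exact (g.constrainedMap_lagrangian₂_iff A hU hm hc hu _).1 (h.2 u hu)
  · intro h
    refine ⟨?_, fun u hu => (g.constrainedMap_lagrangian₂_iff A hU hm hc hu _).2 (h u hu)⟩
    refine (g.isSmoothFieldOn_verticalSolution_add A (m := m) (e := e) hU hc
      (contMDiffOn_const (c := (1 : ℝ)))).congr fun u hu => ?_
    rw [h u hu, solution_eq g A hc hu]

theorem isConstrainedSolution_lagrangian₁_iff (hU : ContMDiff 𝓘(ℝ, E) 𝓘(ℝ, ℝ) ∞ U) (hm : 0 < m)
    (hc : 0 < c) (Z : ∀ u : TB E Q, TTSp u) :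
    IsConstrainedSolution (g.lagrangian₁ A U m e c) (g.constraint c) Z ↔
      ∃ μ : TB E Q → ℝ,
        ContMDiffOn (𝓘(ℝ, E)).tangent 𝓘(ℝ, ℝ) ∞ μ (constraintSet (g.constraint c)) ∧
        ∀ u ∈ constraintSet (g.constraint c),
          Z u = g.verticalSolution U m c u + μ u • g.sigmaField A m e c u := by
  constructor
  · intro h
    -- The factor is recovered from the field by `θ_g`, so smoothness of `Z` makes it smooth on `M`.
    refine ⟨fun u => g.oneForm u (Z u) / c ^ 2, ?_, fun u hu =>
      (g.constrainedMap_lagrangian₁_iff A hU hm hc hu _).1 (h.2 u hu)⟩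
    exact (g.contMDiffOn_oneForm_apply h.1).mul (contMDiffOn_const (c := (c ^ 2)⁻¹))
  · rintro ⟨μ, hμ, h⟩
    refine ⟨(g.isSmoothFieldOn_verticalSolution_add A (m := m) (e := e) hU hc hμ).congr h,
      fun u hu => (g.constrainedMap_lagrangian₁_iff A hU hm hc hu _).2 ?_⟩
    rw [h u hu, oneForm_verticalSolution_add g A hc _ hu]

theorem vertEndo_eq_liouville_iff {u : TB E Q} {w : TTSp u} :
    vertEndo u w = liouville u ↔ dproj u w = u.snd :=
  (vertLift_injective u).eq_iff

theorem isSecondOrderOn_solution (hc : 0 < c) :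
    IsSecondOrderOn (constraintSet (g.constraint c)) (g.solution A U m e c) := by
  intro u hu
  rw [vertEndo_eq_liouville_iff, solution_eq g A hc hu, dproj_verticalSolution_add g A hc 1 hu,
    one_smul]

theorem isSecondOrderOn_congr {s : Set (TB E Q)} {X Y : ∀ u : TB E Q, TTSp u}
    (hX : IsSecondOrderOn s X) (h : ∀ u ∈ s, Y u = X u) : IsSecondOrderOn s Y := by
  intro u hu
  rw [h u hu, hX u hu]

/-- If `Tτ Z = u`, then `θ_g(Z) = c²`, which forces `μ = 1`. -/
theorem isConstrainedSolution_lagrangian₁_secondOrder_iff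
    (hU : ContMDiff 𝓘(ℝ, E) 𝓘(ℝ, ℝ) ∞ U) (hm : 0 < m) (hc : 0 < c)
    (Z : ∀ u : TB E Q, TTSp u) :
    (IsConstrainedSolution (g.lagrangian₁ A U m e c) (g.constraint c) Z ∧
      IsSecondOrderOn (constraintSet (g.constraint c)) Z) ↔
      ∀ u ∈ constraintSet (g.constraint c), Z u = g.solution A U m e c u := by
  rw [g.isConstrainedSolution_lagrangian₁_iff A hU hm hc]
  constructor
  · rintro ⟨⟨μ, -, h⟩, h2⟩ u hu
    have h3 := vertEndo_eq_liouville_iff.1 (h2 u hu)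
    have h4 : μ u = 1 := by
      rw [← oneForm_verticalSolution_add g A (U := U) (m := m) (e := e) hc (μ u) hu, ← h u hu,
        g.oneForm_apply, h3, g.mem_constraintSet_iff.1 hu, div_self (pow_ne_zero 2 hc.ne')]
    rw [h u hu, h4, solution_eq g A hc hu]
  · intro h
    refine ⟨⟨fun _ => 1, contMDiffOn_const, fun u hu => ?_⟩,
      isSecondOrderOn_congr (g.isSecondOrderOn_solution A hc) h⟩
    rw [h u hu, solution_eq g A hc hu]

end LorentzMetric

end
theorem mainTheorem10 {E : Type*} [NormedAddCommGroup E] [NormedSpace ℝ E]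
    (hE : Module.finrank ℝ E = 4) {Q : Type*} [TopologicalSpace Q] [ChartedSpace E Q]
    [IsManifold 𝓘(ℝ, E) ∞ Q] (g : LorentzMetric E Q) (A : SmoothOneForm E Q) (U : Q → ℝ)
    (hU : ContMDiff 𝓘(ℝ, E) 𝓘(ℝ, ℝ) ∞ U) (m e c : ℝ) (hm : 0 < m) (hc : 0 < c) :
    -- the constraint restricts only velocities: `M → Q` is onto and `ᵗJ ∘ dφ ≠ 0` along `M`
    ((∀ q : Q, ∃ u ∈ constraintSet (g.constraint c), u.proj = q) ∧
      ∀ u ∈ constraintSet (g.constraint c),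
        (differential (𝓘(ℝ, E)).tangent (g.constraint c) u).comp (vertEndo u) ≠ 0) ∧
    -- `ω_g` is symplectic, so that `S_g` is the unique solution of `i_S ω_g = dE_g`
    (∀ u : TB E Q, Function.Bijective (g.twoForm u) ∧
      g.twoForm u (g.geodesicField u) = differential (𝓘(ℝ, E)).tangent g.energy u) ∧
    -- `L₂` is a regular lagrangian, its constrained system is regular, and `X` is the solution
    ((∀ u : TB E Q, Function.Bijective (lagrangeTwoForm (g.lagrangian₂ A U m e c) u)) ∧
      IsRegularConstrained (g.lagrangian₂ A U m e c) (g.constraint c) ∧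
      ∀ Z : ∀ u : TB E Q, TTSp u,
        IsConstrainedSolution (g.lagrangian₂ A U m e c) (g.constraint c) Z ↔
          ∀ u ∈ constraintSet (g.constraint c), Z u = g.solution A U m e c u) ∧
    -- `L₁` is a singular lagrangian, its constrained system is consistent but not regular,
    -- and its solutions are the vector fields `Y + μ Σ`
    ((∀ u : TB E Q, 0 < g.normSq u →
        ¬ Function.Injective (lagrangeTwoForm (g.lagrangian₁ A U m e c) u)) ∧
      IsConsistentConstrained (g.lagrangian₁ A U m e c) (g.constraint c) ∧
      (∀ u ∈ constraintSet (g.constraint c),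
        ¬ Function.Bijective
          (constrainedMap (g.lagrangian₁ A U m e c) (g.constraint c) u)) ∧
      ∀ Z : ∀ u : TB E Q, TTSp u,
        IsConstrainedSolution (g.lagrangian₁ A U m e c) (g.constraint c) Z ↔
          ∃ μ : TB E Q → ℝ,
            ContMDiffOn (𝓘(ℝ, E)).tangent 𝓘(ℝ, ℝ) ∞ μ (constraintSet (g.constraint c)) ∧
            ∀ u ∈ constraintSet (g.constraint c),
              Z u = g.verticalSolution U m c u + μ u • g.sigmaField A m e c u) ∧
    -- `X` is second-order, and is the unique second-order solution for both lagrangians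
    (IsSecondOrderOn (constraintSet (g.constraint c)) (g.solution A U m e c) ∧
      (∀ Z : ∀ u : TB E Q, TTSp u,
        (IsConstrainedSolution (g.lagrangian₁ A U m e c) (g.constraint c) Z ∧
            IsSecondOrderOn (constraintSet (g.constraint c)) Z) ↔
          ∀ u ∈ constraintSet (g.constraint c), Z u = g.solution A U m e c u) ∧
      ∀ Z : ∀ u : TB E Q, TTSp u,
        (IsConstrainedSolution (g.lagrangian₂ A U m e c) (g.constraint c) Z ∧
            IsSecondOrderOn (constraintSet (g.constraint c)) Z) ↔
          ∀ u ∈ constraintSet (g.constraint c), Z u = g.solution A U m e c u) := by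
  have : FiniteDimensional ℝ E := Module.finite_of_finrank_pos (by omega)
  refine ⟨⟨g.exists_mem_constraintSet c, fun u hu =>
    g.differential_constraint_comp_vertEndo_ne_zero hc hu⟩,
    fun u => ⟨g.twoForm_bijective u, g.twoForm_geodesicField u⟩,
    ⟨g.lagrangeTwoForm_lagrangian₂_bijective A hU hm,
      g.isRegularConstrained_lagrangian₂ A hU hm hc,
      g.isConstrainedSolution_lagrangian₂_iff A hU hm hc⟩,
    ⟨g.lagrangeTwoForm_lagrangian₁_not_injective A hU,
      -- Consistency is witnessed by the choice `μ = 0`, that is, by `Y`.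
      ⟨_, (g.isConstrainedSolution_lagrangian₁_iff A hU hm hc _).2
        ⟨fun _ => 0, contMDiffOn_const, fun _ _ => rfl⟩⟩,
      fun u hu => g.constrainedMap_lagrangian₁_not_bijective A hU hm hc hu,
      g.isConstrainedSolution_lagrangian₁_iff A hU hm hc⟩,
    g.isSecondOrderOn_solution A hc,
    g.isConstrainedSolution_lagrangian₁_secondOrder_iff A hU hm hc, fun Z => ?_⟩
  -- For `L₂` the solution is already unique, and the second-order condition follows from it.
  rw [g.isConstrainedSolution_lagrangian₂_iff A hU hm hc]
  exact and_iff_left_of_imp fun h =>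
    LorentzMetric.isSecondOrderOn_congr (g.isSecondOrderOn_solution A hc) h
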